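/- A generalized torsion element of a group $G$ is an element $g\neq 1$ such that $(y_1^{-1}gy_1)(y_2^{-1}gy_2)\cdots(y_k^{-1}gy_k)=1$ for some $k\ge 1$ and $y_1,\dots,y_k\in G$. A knot is a subset $K\subset\mathbb R^3$ homeomorphic to the circle $S^1$ which is either smooth (the image of a smooth embedding of the circle) or piecewise linear (a finite union of line segments); its group is $\pi_1(\mathbb R^3\setminus K)$. A knot $K$ is a connected sum of knots $K_1$ and $K_2$ if, up to ambient isotopy of each of $K_1$, $K_2$, $K$ in $\mathbb R^3$, $K_1$ lies in $\{z\le 0\}$, $K_2$ lies in $\{z\ge 0\}$, each of them meets the plane $\{z=0\}$ exactly in the same nondegenerate segment $[a,b]$, and $K$ is $K_1\cup K_2$ with the interior of $[a,b]$ removed. Let $K$ be a connected sum of knots $K_1$ and $K_2$. If the group of $K_1$ or the group of $K_2$ contains a generalized torsion element, then the group of $K$ contains a generalized torsion element. -/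

import Mathlib

open scoped ContDiff

namespace KnotSum

/-- A generalized torsion element of a group: a nontrivial element `x` such that some nonempty
finite product of conjugates `y⁻¹ * x * y` of `x` is the identity. -/
def IsGeneralizedTorsion {G : Type*} [Group G] (x : G) : Prop :=
  x ≠ 1 ∧ ∃ l : List G, l ≠ [] ∧ (l.map fun y => y⁻¹ * x * y).prod = 1

/-- The group contains a generalized torsion element. -/
def HasGeneralizedTorsion (G : Type*) [Group G] : Prop :=
  ∃ x : G, IsGeneralizedTorsion x

/-- Euclidean 3-space. -/
abbrev E3 : Type := EuclideanSpace ℝ (Fin 3)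

/-- A finite union of straight line segments. -/
def IsPiecewiseLinear (K : Set E3) : Prop :=
  ∃ S : Finset (E3 × E3), K = ⋃ p ∈ S, segment ℝ p.1 p.2

/-- The image of a smooth embedding of the circle `ℝ / ℤ`: a smooth, regular, `1`-periodic
parametrization which is injective on a period. -/
def IsSmoothCurve (K : Set E3) : Prop :=
  ∃ γ : ℝ → E3, ContDiff ℝ ∞ γ ∧ Function.Periodic γ 1 ∧ Set.InjOn γ (Set.Ico 0 1) ∧
    (∀ t, deriv γ t ≠ 0) ∧ Set.range γ = K

/-- A classical knot: a subset of Euclidean 3-space homeomorphic to the circle, which is smooth or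
piecewise linear. -/
def IsKnot (K : Set E3) : Prop :=
  Nonempty (K ≃ₜ Circle) ∧ (IsSmoothCurve K ∨ IsPiecewiseLinear K)

/-- The knot group: the fundamental group of the complement of `K`, at a base point. -/
abbrev KnotGroup (K : Set E3) (x : ↥Kᶜ) : Type := FundamentalGroup ↥Kᶜ x

/-- Two subsets of 3-space are equivalent if an ambient isotopy (a continuous family of
homeomorphisms of the whole space that starts at the identity) carries the first to the second. -/
def AmbientIsotopic (A B : Set E3) : Prop :=
  ∃ F : unitInterval → (E3 ≃ₜ E3),
    Continuous (fun p : unitInterval × E3 => F p.1 p.2) ∧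
      F 0 = Homeomorph.refl E3 ∧ F 1 '' A = B

/-- `K` is a connected sum of `K₁` and `K₂`: up to ambient isotopy, `K₁` lies in a closed half-space
and `K₂` in the opposite one, each of them meets the bounding plane exactly in one and the same
nondegenerate line segment `[a, b]`, and `K` is the union of the two with the interior of that
segment removed. (Equivalently: the plane cuts `K` in the two points `a`, `b` into two arcs, and
closing up the arcs by `[a, b]` gives `K₁` and `K₂`.) Knots are not oriented here, so both ways of
matching orientations yield connected sums. -/
def IsConnectedSum (K₁ K₂ K : Set E3) : Prop :=
  ∃ (Q₁ Q₂ : Set E3) (a b : E3),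
    a ≠ b ∧
    Q₁ ⊆ {x | x 2 ≤ 0} ∧ Q₂ ⊆ {x | 0 ≤ x 2} ∧
    Q₁ ∩ {x | x 2 = 0} = segment ℝ a b ∧
    Q₂ ∩ {x | x 2 = 0} = segment ℝ a b ∧
    AmbientIsotopic K₁ Q₁ ∧ AmbientIsotopic K₂ Q₂ ∧
    AmbientIsotopic K ((Q₁ ∪ Q₂) \ openSegment ℝ a b)

end KnotSum

/-! Generalized torsion in the group of a connected sum of knots. -/

/-! The group of a summand embeds in the group of `K`, and an injective homomorphism preserves
generalized torsion. Algebraically, the group of `K` is the amalgam of the two knot groups along a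
meridian, and abelianizing one factor retracts the amalgam onto the other. The proof realizes this
retraction by maps of spaces and avoids van Kampen's theorem. Smoothness or piecewise linearity is
used only to make the complement of `K` path connected.

Let the common plane have height zero and the common segment be [-1, 1] in ℂ. Let `A` and `B` be the
lower and upper arcs, so that the first curve is `A ∪ unitSeg` and the sum is `A ∪ B`. The Möbius
map `mob` identifies the plane without ±1 with part of ℂ \ {0}. Composed with a map of a compact
space into the complement of `A ∪ B`, it extends without zeros over the part that lands in the upper
half-space (`exists_extension_mob`). This expresses linking with the second curve: as q runs along
`B` from -1 to 1, a spinor over the displacement from the moving point to q is transported, and its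
last coordinate at the end is the extension up to an exponential. Only short-step chains in `B` are
needed, not a path.

`rho` folds the lower half-space into a half-ball that contains `A`, and `kap` inverts `mob`
compatibly with `rho`. The upper half-space can thus be collapsed to a disc and a hemisphere, away
from ±1. Pushing down by `lower` gives maps into the complement of the first curve
(`exists_retract`). In the other direction, a logarithm of `mob` off the segment gives a map e from
the complement of the first curve to that of the sum (`exists_collapse`).

Following e by the retraction gives a self-map g that is homotopic to the identity over the lower
half-space. This half-space carries all loops, since the rest lies in the contractible region
outside the shadow of the curve. So g, and with it e, kills no nontrivial loop
(`IsLowerArc.exists_detectsLoops`). -/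

namespace KnotSum

/-! ### Spinors over displacement vectors -/

open Complex ComplexConjugate

/-- Euclidean length on `ℂ × ℝ`. -/
noncomputable def len (v : ℂ × ℝ) : ℝ := √(normSq v.1 + v.2 ^ 2)

/-- Euclidean inner product on `ℂ × ℝ`. -/
noncomputable def dot (v w : ℂ × ℝ) : ℝ := (v.1 * conj w.1).re + v.2 * w.2

theorem continuous_len : Continuous len := by
  unfold len
  have := continuous_normSq
  fun_prop

theorem len_nonneg (v : ℂ × ℝ) : 0 ≤ len v := Real.sqrt_nonneg _

theorem len_sq (v : ℂ × ℝ) : len v ^ 2 = normSq v.1 + v.2 ^ 2 :=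
  Real.sq_sqrt (add_nonneg (normSq_nonneg _) (sq_nonneg _))

theorem len_sq_complex (v : ℂ × ℝ) : (len v : ℂ) ^ 2 = v.1 * conj v.1 + (v.2 : ℂ) ^ 2 := by
  rw [mul_conj]; exact_mod_cast congrArg ((↑) : ℝ → ℂ) (len_sq v)

theorem abs_snd_le_len (v : ℂ × ℝ) : |v.2| ≤ len v :=
  Real.abs_le_sqrt (le_add_of_nonneg_left (normSq_nonneg _))

theorem norm_fst_le_len (v : ℂ × ℝ) : ‖v.1‖ ≤ len v := by
  rw [Complex.norm_def]
  exact Real.sqrt_le_sqrt (le_add_of_nonneg_right (sq_nonneg _))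

theorem dot_complex (v w : ℂ × ℝ) :
    (2 * dot v w : ℂ) = v.1 * conj w.1 + conj v.1 * w.1 + 2 * v.2 * w.2 := by
  apply Complex.ext <;> simp [dot] <;> ring

/-- The norm is the maximum of the two component norms, so the squared Euclidean length of `v - w`
is below 2δ², while those of `v` and `w` are at least δ²; polarization gives the sign. -/
theorem dot_pos_of_dist_lt {v w : ℂ × ℝ} {δ : ℝ} (hv : δ ≤ ‖v‖) (hw : δ ≤ ‖w‖)
    (hvw : ‖v - w‖ < δ) : 0 < dot v w := by
  have hδ : 0 < δ := (norm_nonneg _).trans_lt hvw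
  have key : ∀ u : ℂ × ℝ, δ ≤ ‖u‖ → δ ^ 2 ≤ normSq u.1 + u.2 ^ 2 := by
    intro u hu
    rw [Prod.norm_def, le_max_iff] at hu
    rw [normSq_eq_norm_sq]
    rcases hu with hu | hu
    · nlinarith [sq_nonneg u.2]
    · rw [Real.norm_eq_abs] at hu
      nlinarith [sq_abs u.2, sq_nonneg ‖u.1‖]
  have h3 : normSq (v - w).1 + (v - w).2 ^ 2 < 2 * δ ^ 2 := by
    rw [normSq_eq_norm_sq]
    rw [Prod.norm_def, max_lt_iff, Real.norm_eq_abs] at hvw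
    have := sq_abs (v - w).2
    nlinarith [norm_nonneg (v - w).1, abs_nonneg (v - w).2]
  have h4 : normSq (v - w).1 + (v - w).2 ^ 2
      = (normSq v.1 + v.2 ^ 2) + (normSq w.1 + w.2 ^ 2) - 2 * dot v w := by
    simp [dot, normSq_apply]; ring
  linarith [key v hv, key w hw]

/-- `(α, β)` is a nonzero eigenvector, for the eigenvalue `len v`, of the matrix
`!![v.2, conj v.1; v.1, -v.2]`. -/
structure IsSpinor (v : ℂ × ℝ) (α β : ℂ) : Prop where
  fst_eq : conj v.1 * β = (len v - v.2) * α
  snd_eq : v.1 * α = (len v + v.2) * β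
  ne_zero : α ≠ 0 ∨ β ≠ 0

/-- The new pair is the old one under len w + M_w, where M_w is the matrix of `w`: up to scale, the
projection to the eigenline of `w`. If it vanished, the anticommutator M_v M_w + M_w M_v = 2 dot v w
would act on the old spinor as -2 len v len w, which is impossible for a positive inner product. -/
theorem IsSpinor.step {v w : ℂ × ℝ} {α β : ℂ} (h : IsSpinor v α β) (hvw : 0 < dot v w) :
    IsSpinor w ((len w + w.2) * α + conj w.1 * β) (w.1 * α + (len w - w.2) * β) := by
  have hw := len_sq_complex w
  refine ⟨by linear_combination (-α) * hw, by linear_combination (-β) * hw, ?_⟩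
  by_contra! hne
  obtain ⟨h1, h2⟩ := hne
  have hd := dot_complex v w
  have hpos : (2 * dot v w + 2 * (len v * len w) : ℂ) ≠ 0 := by
    have : 0 < 2 * dot v w + 2 * (len v * len w) := by
      have := mul_nonneg (len_nonneg v) (len_nonneg w); linarith
    exact_mod_cast this.ne'
  have hα : (2 * dot v w + 2 * (len v * len w) : ℂ) * α = 0 := by
    rw [hd]
    linear_combination conj w.1 * h.snd_eq + (len v + v.2 : ℂ) * h1 + conj v.1 * h2
      - (len w - w.2 : ℂ) * h.fst_eq
  have hβ : (2 * dot v w + 2 * (len v * len w) : ℂ) * β = 0 := by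
    rw [hd]
    linear_combination w.1 * h.fst_eq + (len v - v.2 : ℂ) * h2 + v.1 * h1
      - (len w + w.2 : ℂ) * h.snd_eq
  rcases h.ne_zero with h0 | h0
  · exact (mul_ne_zero hpos h0) hα
  · exact (mul_ne_zero hpos h0) hβ

theorem isSpinor_down {v : ℂ × ℝ} (hv : v ≠ 0) (hz : v.2 ≤ 0) :
    IsSpinor v (conj v.1) (len v - v.2) := by
  have hl := len_sq_complex v
  refine ⟨by ring, by linear_combination -hl, ?_⟩
  by_contra! h
  obtain ⟨h1, h2⟩ := h
  have h2' : len v - v.2 = 0 := by exact_mod_cast h2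
  have h3 : v.2 = 0 := le_antisymm hz (by linarith [len_nonneg v])
  exact hv (Prod.ext (by simpa using h1) h3)

/-- The second coordinate of a spinor vanishes only over vertical upward vectors. At the end of the
chain this makes the transported coordinate a function without zeros. -/
theorem IsSpinor.snd_ne_zero {v : ℂ × ℝ} {α β : ℂ} (h : IsSpinor v α β) (hv : v ≠ 0)
    (hz : v.2 ≤ 0) : β ≠ 0 := by
  intro hβ
  have hα : α ≠ 0 := h.ne_zero.resolve_right (not_not.2 hβ)
  have h1 := h.fst_eq
  have h2 := h.snd_eq
  simp only [hβ, mul_zero] at h1 h2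
  have h3 : len v - v.2 = 0 := by
    have := (mul_eq_zero.1 h1.symm).resolve_right hα; exact_mod_cast this
  have h4 : v.2 = 0 := le_antisymm hz (by linarith [len_nonneg v])
  exact hv (Prod.ext ((mul_eq_zero.1 h2).resolve_right hα) h4)

/-- The Hermitian product of the standard spinors over two non-antipodal upper directions has
positive real part. -/
theorem spinor_product_re_pos {v w : ℂ × ℝ} (hv : 0 ≤ v.2) (hw : 0 ≤ w.2) (h : 0 < dot v w) :
    0 < (((len w + w.2) * (len v + v.2) : ℂ) + conj w.1 * v.1).re := by
  have hre : (((len w + w.2) * (len v + v.2) : ℂ) + conj w.1 * v.1).re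
      = (len w + w.2) * (len v + v.2) + (v.1 * conj w.1).re := by
    simp; ring
  rw [hre]
  have h1 : 0 < (v.1 * conj w.1).re + v.2 * w.2 := h
  have := mul_nonneg (len_nonneg v) (len_nonneg w)
  have := mul_nonneg (len_nonneg v) hw
  have := mul_nonneg (len_nonneg w) hv
  nlinarith

theorem ne_zero_of_dot_pos_right {v w : ℂ × ℝ} (h : 0 < dot v w) : 0 < len w := by
  rcases (len_nonneg w).lt_or_eq with h' | h'
  · exact h'
  · exfalso
    have h2 := norm_fst_le_len w
    have h3 := abs_snd_le_len w
    rw [← h'] at h2 h3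
    have h4 : w.1 = 0 := norm_le_zero_iff.1 h2
    have h5 : w.2 = 0 := abs_nonpos_iff.1 h3
    simp [dot, h4, h5] at h

/-- A family of spinors over the displacement field `q - h`, in the form of a product of
projections, whose values over points at height zero differ from the standard spinor by an explicit
factor and the exponential of a continuous function. -/
def HasSpinorField {T : Type*} [TopologicalSpace T] (h : T → ℂ × ℝ) (b q : ℂ × ℝ) : Prop :=
  ∃ α β : C(T, ℂ), (∀ t, IsSpinor (q - h t) (α t) (β t)) ∧
    ∃ u : C({t // (h t).2 = 0}, ℂ), ∀ t : {t // (h t).2 = 0},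
      α t = conj (b - h t).1 * exp (u t) * (len (q - h t) + (q - h t).2) ∧
      β t = conj (b - h t).1 * exp (u t) * (q - h t).1

variable {T : Type*} [TopologicalSpace T] {h : T → ℂ × ℝ}

/-- Over horizontal v, the spinor (conj v.1, len v) is conj v.1 / len v times the upper standard
spinor (len v, v.1), so the exponent is -log len. -/
theorem hasSpinorField_start (hc : Continuous h) (hz : ∀ t, 0 ≤ (h t).2) {b : ℂ × ℝ}
    (hb : b.2 = 0) (hne : ∀ t, h t ≠ b) : HasSpinorField h b b := by
  have hlen : ∀ t, 0 < len (b - h t) := by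
    intro t
    rcases (len_nonneg (b - h t)).lt_or_eq with h' | h'
    · exact h'
    · exfalso
      have h2 := norm_fst_le_len (b - h t)
      have h3 := abs_snd_le_len (b - h t)
      rw [← h'] at h2 h3
      exact hne t (sub_eq_zero.1 (Prod.ext (norm_le_zero_iff.1 h2) (abs_nonpos_iff.1 h3))).symm
  have hcl : Continuous fun t => len (b - h t) := continuous_len.comp (by fun_prop)
  refine ⟨⟨fun t => conj (b - h t).1, by fun_prop⟩,
    ⟨fun t => len (b - h t) - (b - h t).2, by fun_prop⟩, fun t => ?_,
    ⟨fun t => -(Real.log (len (b - h t)) : ℂ), ?_⟩, ?_⟩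
  · refine isSpinor_down (sub_ne_zero.2 (hne t).symm) ?_
    have := hz t
    simp [hb, this]
  · have : Continuous fun t => Real.log (len (b - h t)) := hcl.log fun t => (hlen t).ne'
    exact ((continuous_ofReal.comp this).comp continuous_subtype_val).neg
  · rintro ⟨t, ht⟩
    have hz0 : (b - h t).2 = 0 := by simp [hb, ht]
    have hl0 : (len (b - h t) : ℂ) ≠ 0 := by exact_mod_cast (hlen t).ne'
    have he : exp (-(Real.log (len (b - h t)) : ℂ)) = (len (b - h t) : ℂ)⁻¹ := by
      rw [Complex.exp_neg, ← ofReal_exp, Real.exp_log (hlen t)]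
    have hsq := len_sq_complex (b - h t)
    simp only [ContinuousMap.coe_mk, he, hz0, ofReal_zero, add_zero, sub_zero] at hsq ⊢
    constructor
    · field_simp
    · field_simp
      linear_combination hsq

theorem HasSpinorField.step (hc : Continuous h) {b q r : ℂ × ℝ}
    (hq : 0 ≤ q.2) (hr : 0 ≤ r.2) (hqr : ∀ t, 0 < dot (q - h t) (r - h t))
    (H : HasSpinorField h b q) : HasSpinorField h b r := by
  obtain ⟨α, β, hs, u, hu⟩ := H
  have hcl : ∀ q, Continuous fun t => len (q - h t) := fun q => continuous_len.comp (by fun_prop)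
  have hclq := hcl q
  have hclr := hcl r
  set D : T → ℂ := fun t => ((len (r - h t) + (r - h t).2) * (len (q - h t) + (q - h t).2) : ℂ) +
    conj (r - h t).1 * (q - h t).1 with hD
  have hDc : Continuous D := by fun_prop
  have hDre : ∀ t : {t // (h t).2 = 0}, 0 < (D t).re := by
    rintro ⟨t, ht⟩
    exact spinor_product_re_pos (by simp [ht, hq]) (by simp [ht, hr]) (hqr t)
  have hN : ∀ t : {t // (h t).2 = 0}, 0 < len (r - h t) + (r - h t).2 := by
    rintro ⟨t, ht⟩
    have h1 := ne_zero_of_dot_pos_right (hqr t)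
    have h2 : 0 ≤ (r - h t).2 := by simp [ht, hr]
    simpa using add_pos_of_pos_of_nonneg h1 h2
  refine ⟨⟨fun t => (len (r - h t) + (r - h t).2) * α t + conj (r - h t).1 * β t, by fun_prop⟩,
    ⟨fun t => (r - h t).1 * α t + (len (r - h t) - (r - h t).2) * β t, by fun_prop⟩,
    fun t => (hs t).step (hqr t),
    -- Projecting the upper standard spinor of the old displacement gives D / (len + height) times
    -- that of the new one, and Re D > 0 makes the principal logarithm continuous.
    ⟨fun t => u t + log (D t) - Real.log (len (r - h t) + (r - h t).2), ?_⟩, ?_⟩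
  · have h1 : Continuous fun t : {t // (h t).2 = 0} => log (D t) :=
      (hDc.comp continuous_subtype_val).clog fun t => Or.inl (hDre t)
    have h2 : Continuous fun t : {t // (h t).2 = 0} =>
        Real.log (len (r - h t) + (r - h t).2) := by
      refine Continuous.log ?_ fun t => (hN t).ne'
      exact (hclr.add (by fun_prop : Continuous fun t => (r - h t).2)).comp continuous_subtype_val
    fun_prop
  · intro t
    have hD0 : D t ≠ 0 := fun h0 => by have := hDre t; simp [h0] at this
    have hN0 : (len (r - h t) + (r - h t).2 : ℂ) ≠ 0 := by exact_mod_cast (hN t).ne'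
    have he : exp (u t + log (D t) - Real.log (len (r - h t) + (r - h t).2))
        = exp (u t) * D t / (len (r - h t) + (r - h t).2) := by
      rw [Complex.exp_sub, Complex.exp_add, exp_log hD0, ← ofReal_exp, Real.exp_log (hN t)]
      push_cast; rfl
    have hsq := len_sq_complex (r - h t)
    obtain ⟨h1, h2⟩ := hu t
    simp only [ContinuousMap.coe_mk, he, h1, h2]
    constructor
    · field_simp
      simp only [hD]
    · field_simp
      simp only [hD]
      linear_combination (conj (b - h t).1 * (q - h t).1) * hsq

end KnotSum

/-! ### Extending the Möbius coordinate over the upper half-space -/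

namespace KnotSum

open Complex ComplexConjugate

/-- The Möbius transformation that carries `1` to `0` and `-1` to `∞`. -/
noncomputable def mob (c : ℂ) : ℂ := (c - 1) / (c + 1)

/-- Steps of length less than `δ` between points of `A`. -/
def ShortStep (A : Set (ℂ × ℝ)) (δ : ℝ) (q r : ℂ × ℝ) : Prop :=
  q ∈ A ∧ r ∈ A ∧ dist q r < δ

theorem hasSpinorField_of_chain {T : Type*} [TopologicalSpace T] {h : T → ℂ × ℝ}
    (hc : Continuous h) (hz : ∀ t, 0 ≤ (h t).2) {A : Set (ℂ × ℝ)} (hA : ∀ q ∈ A, 0 ≤ q.2) {δ : ℝ}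
    (hδ : 0 < δ) (hd : ∀ t, ∀ q ∈ A, δ ≤ dist q (h t)) {b q : ℂ × ℝ} (hbA : b ∈ A) (hb : b.2 = 0)
    (hq : Relation.ReflTransGen (ShortStep A δ) b q) : HasSpinorField h b q := by
  induction hq with
  | refl =>
    refine hasSpinorField_start hc hz hb fun t ht => ?_
    have := hd t b hbA
    rw [ht, dist_self] at this
    linarith
  | tail _ hstep ih =>
    obtain ⟨h1, h2, h3⟩ := hstep
    refine ih.step hc (hA _ h1) (hA _ h2) fun t => ?_
    refine dot_pos_of_dist_lt (δ := δ) ?_ ?_ ?_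
    · rw [← dist_eq_norm]; exact hd t _ h1
    · rw [← dist_eq_norm]; exact hd t _ h2
    · rwa [sub_sub_sub_cancel_right, ← dist_eq_norm]

/-- The Möbius transformation of the plane, composed with `h`, extends over the upper
half-space away from a chain that joins `-1` to `1`. -/
theorem exists_extension_mob {T : Type*} [TopologicalSpace T] [NormalSpace T] {h : T → ℂ × ℝ}
    (hc : Continuous h) (hz : ∀ t, 0 ≤ (h t).2) {A : Set (ℂ × ℝ)} (hA : ∀ q ∈ A, 0 ≤ q.2) {δ : ℝ}
    (hδ : 0 < δ) (hd : ∀ t, ∀ q ∈ A, δ ≤ dist q (h t)) (hbA : ((-1 : ℂ), (0 : ℝ)) ∈ A)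
    (haA : ((1 : ℂ), (0 : ℝ)) ∈ A)
    (hq : Relation.ReflTransGen (ShortStep A δ) ((-1 : ℂ), (0 : ℝ)) ((1 : ℂ), (0 : ℝ))) :
    ∃ S : C(T, ℂ), (∀ t, S t ≠ 0) ∧ ∀ t, (h t).2 = 0 → S t = mob (h t).1 := by
  obtain ⟨α, β, hs, u, hu⟩ := hasSpinorField_of_chain hc hz hA hδ hd hbA rfl hq
  have hne : ∀ t, ∀ q ∈ A, h t ≠ q := by
    intro t q hqA ht
    have := hd t q hqA
    rw [ht, dist_self] at this
    linarith
  have hβ : ∀ t, β t ≠ 0 := by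
    intro t
    refine (hs t).snd_ne_zero (sub_ne_zero.2 (hne t _ haA).symm) ?_
    simpa using hz t
  have hplus : ∀ t : {t // (h t).2 = 0}, (h t).1 + 1 ≠ 0 := by
    rintro ⟨t, ht⟩ h0
    exact hne t _ hbA (Prod.ext (eq_neg_of_add_eq_zero_left h0) ht)
  have hcl : IsClosed {t | (h t).2 = 0} :=
    isClosed_eq (continuous_snd.comp hc) continuous_const
  have hnc := continuous_normSq
  -- At the end point 1 the coordinate is conj(-1 - c) · exp u · (1 - c), with c = (h t).1. Dividing
  -- by exp u · |c + 1|² leaves (c - 1)/(c + 1). This divisor is an exponential, so Tietze extension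
  -- of its exponent keeps it free of zeros.
  let v : C({t | (h t).2 = 0}, ℂ) :=
    ⟨fun t => u t + Real.log (normSq ((h t).1 + 1)), by
      have : Continuous fun t : {t | (h t).2 = 0} => Real.log (normSq ((h t).1 + 1)) := by
        refine Continuous.log (by fun_prop) fun t => ?_
        exact (normSq_pos.2 (hplus t)).ne'
      have h2 : Continuous fun t : {t | (h t).2 = 0} => u t := u.continuous
      fun_prop⟩
  obtain ⟨w, hw⟩ := v.exists_restrict_eq hcl
  refine ⟨⟨fun t => β t * exp (-w t), by fun_prop⟩,
    fun t => mul_ne_zero (hβ t) (exp_ne_zero _), fun t ht => ?_⟩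
  have hwt : w t = u ⟨t, ht⟩ + Real.log (normSq ((h t).1 + 1)) :=
    DFunLike.congr_fun hw (⟨t, ht⟩ : {t | (h t).2 = 0})
  have h1 : (h t).1 + 1 ≠ 0 := hplus ⟨t, ht⟩
  have h2 : conj ((h t).1 + 1) ≠ 0 := (map_ne_zero _).2 h1
  have hβt := (hu ⟨t, ht⟩).2
  have he := exp_ne_zero (u ⟨t, ht⟩)
  simp only [ContinuousMap.coe_mk, hwt, hβt]
  rw [neg_add, Complex.exp_add, Complex.exp_neg, Complex.exp_neg, ← ofReal_exp,
    Real.exp_log (normSq_pos.2 h1), normSq_eq_conj_mul_self, mob]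
  have h3 : conj (((-1 : ℂ), (0 : ℝ)) - h t).1 = -conj ((h t).1 + 1) := by
    simp; ring
  rw [h3]
  simp only [Prod.fst_sub]
  field_simp
  ring

/-- In a closed set that no separation splits between `p` and `q`, short steps lead from `p` to
`q`. -/
theorem exists_chain {A : Set (ℂ × ℝ)} (hA : IsClosed A) {p q : ℂ × ℝ} (hp : p ∈ A) (hq : q ∈ A)
    (hsep : ∀ M N : Set (ℂ × ℝ), IsClosed M → IsClosed N → Disjoint M N → M ∪ N = A → p ∈ M →
      q ∉ N) {δ : ℝ} (hδ : 0 < δ) : Relation.ReflTransGen (ShortStep A δ) p q := by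
  by_contra hcon
  set M : Set (ℂ × ℝ) := {x ∈ A | Relation.ReflTransGen (ShortStep A δ) p x} with hM
  set N : Set (ℂ × ℝ) := {x ∈ A | ¬ Relation.ReflTransGen (ShortStep A δ) p x} with hN
  refine hsep M N ?_ ?_ ?_ ?_ ⟨hp, .refl⟩ ⟨hq, hcon⟩
  · refine isClosed_of_closure_subset fun x hx => ?_
    have hxA : x ∈ A := hA.closure_subset_iff.2 (fun y hy => hy.1) hx
    obtain ⟨y, hy, hxy⟩ := Metric.mem_closure_iff.1 hx δ hδ
    exact ⟨hxA, hy.2.tail ⟨hy.1, hxA, by rwa [dist_comm]⟩⟩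
  · refine isClosed_of_closure_subset fun x hx => ?_
    have hxA : x ∈ A := hA.closure_subset_iff.2 (fun y hy => hy.1) hx
    obtain ⟨y, hy, hxy⟩ := Metric.mem_closure_iff.1 hx δ hδ
    exact ⟨hxA, fun h => hy.2 (h.tail ⟨hxA, hy.1, hxy⟩)⟩
  · exact Set.disjoint_left.2 fun x h1 h2 => h2.2 h1.2
  · ext x
    simp only [hM, hN, Set.mem_union, Set.mem_ofPred_eq]
    tauto

/-! ### Folding the lower half-space; the plane closed up to a sphere -/

/-- The point of the lower hemisphere of radius `R` below `y`. -/
noncomputable def hemi (R : ℝ) (y : ℂ) : ℂ × ℝ := (y, -√(R ^ 2 - normSq y))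

/-- A retraction of the lower half-space onto the lower half-ball of radius `R`. -/
noncomputable def rho (R : ℝ) (p : ℂ × ℝ) : ℂ × ℝ :=
  if len p ≤ R then (p.1, -|p.2|) else hemi R ((R ^ 2 / len p ^ 2 : ℝ) * p.1)

/-- The inverse of `mob` followed by `rho`, extended continuously to all complex numbers. -/
noncomputable def kap (R : ℝ) (w : ℂ) : ℂ × ℝ :=
  if ‖1 + w‖ ≤ R * ‖1 - w‖ then ((1 + w) / (1 - w), 0)
  else hemi R ((R ^ 2 : ℝ) * conj ((1 - w) / (1 + w)))

/-- The taxicab length of the horizontal and the vertical component. -/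
noncomputable def taxi (p : ℂ × ℝ) : ℝ := ‖p.1‖ + |p.2|

theorem continuous_hemi (R : ℝ) : Continuous (hemi R) := by
  have := continuous_normSq
  unfold hemi
  fun_prop

theorem len_le_taxi (p : ℂ × ℝ) : len p ≤ taxi p := by
  refine Real.sqrt_le_iff.2 ⟨by unfold taxi; positivity, ?_⟩
  rw [normSq_eq_norm_sq, taxi, ← sq_abs p.2]
  nlinarith [norm_nonneg p.1, abs_nonneg p.2]

theorem len_hemi {R : ℝ} {y : ℂ} (hy : ‖y‖ ≤ R) : len (hemi R y) = R := by
  have hR : 0 ≤ R := (norm_nonneg y).trans hy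
  have : 0 ≤ R ^ 2 - normSq y := by
    rw [normSq_eq_norm_sq]; nlinarith [norm_nonneg y]
  rw [len, hemi]
  simp only [neg_sq]
  rw [Real.sq_sqrt this, add_sub_cancel, Real.sqrt_sq hR]

theorem le_taxi_hemi {R : ℝ} {y : ℂ} (hy : ‖y‖ ≤ R) : R ≤ taxi (hemi R y) :=
  (len_hemi hy).symm.le.trans (len_le_taxi _)

theorem continuous_rho {R : ℝ} (hR : 0 < R) : Continuous (rho R) := by
  have hl := continuous_len
  have hh := continuous_hemi R
  unfold rho
  refine continuous_if_le hl continuous_const (by fun_prop) ?_ ?_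
  · refine hh.comp_continuousOn (ContinuousOn.mul ?_ continuousOn_fst)
    refine continuous_ofReal.comp_continuousOn ?_
    refine ContinuousOn.div (by fun_prop) (by fun_prop) fun p hp => ?_
    have : 0 < len p := lt_of_lt_of_le hR hp
    positivity
  · intro p hp
    have h2 := len_sq p
    rw [hp, div_self (by positivity), ofReal_one, one_mul, hemi, Prod.mk.injEq]
    rw [hp] at h2
    refine ⟨rfl, ?_⟩
    rw [h2, add_sub_cancel_left, Real.sqrt_sq_eq_abs]

theorem rho_snd_nonpos (R : ℝ) (p : ℂ × ℝ) : (rho R p).2 ≤ 0 := by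
  unfold rho
  split_ifs <;> simp [hemi]

theorem rho_of_len_le {R : ℝ} {p : ℂ × ℝ} (hp : p.2 ≤ 0) (h : len p ≤ R) : rho R p = p := by
  rw [rho, if_pos h, abs_of_nonpos hp, neg_neg]

theorem norm_rho_center_le {R : ℝ} (hR : 0 < R) {p : ℂ × ℝ} (h : R < len p) :
    ‖((R ^ 2 / len p ^ 2 : ℝ) : ℂ) * p.1‖ ≤ R := by
  have hl : 0 < len p := hR.trans h
  rw [norm_mul, norm_real, Real.norm_of_nonneg (by positivity), div_mul_eq_mul_div,
    div_le_iff₀ (by positivity)]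
  have := norm_fst_le_len p
  nlinarith [norm_nonneg p.1, mul_pos hR hl, mul_le_mul_of_nonneg_left this hR.le]

theorem rho_of_lt_len {R : ℝ} (hR : 0 < R) {p : ℂ × ℝ} (h : R < len p) :
    R ≤ taxi (rho R p) ∧ ∃ s : ℝ, 0 ≤ s ∧ (rho R p).1 = s * p.1 := by
  rw [rho, if_neg h.not_ge]
  exact ⟨le_taxi_hemi (norm_rho_center_le hR h), R ^ 2 / len p ^ 2, by positivity, rfl⟩

theorem rho_rho {R : ℝ} (hR : 0 < R) (p : ℂ × ℝ) : rho R (rho R p) = rho R p := by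
  refine rho_of_len_le (rho_snd_nonpos R p) ?_
  by_cases h : len p ≤ R
  · rw [rho, if_pos h]
    simpa [len] using h
  · rw [rho, if_neg h]
    exact (len_hemi (norm_rho_center_le hR (not_le.1 h))).le

theorem continuous_kap {R : ℝ} (hR : 0 < R) : Continuous (kap R) := by
  have hh := continuous_hemi R
  have h1 : ∀ w : ℂ, ‖1 + w‖ ≤ R * ‖1 - w‖ → 1 - w ≠ 0 := by
    intro w hw h0
    rw [h0, norm_zero, mul_zero, norm_le_zero_iff] at hw
    have : (2 : ℂ) = 0 := by linear_combination hw + h0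
    norm_num at this
  have h2 : ∀ w : ℂ, R * ‖1 - w‖ ≤ ‖1 + w‖ → 1 + w ≠ 0 := by
    intro w hw h0
    rw [h0, norm_zero] at hw
    have h3 : ‖1 - w‖ ≤ 0 := by
      by_contra! h; nlinarith [mul_pos hR h]
    rw [norm_le_zero_iff] at h3
    have : (2 : ℂ) = 0 := by linear_combination h3 + h0
    norm_num at this
  unfold kap
  refine continuous_if_le (by fun_prop) (by fun_prop) ?_ ?_ ?_
  · refine ContinuousOn.prodMk (ContinuousOn.div (by fun_prop) (by fun_prop) h1) (by fun_prop)
  · refine hh.comp_continuousOn (ContinuousOn.mul (by fun_prop) ?_)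
    exact continuous_conj.comp_continuousOn (ContinuousOn.div (by fun_prop) (by fun_prop) h2)
  · intro w hw
    have e1 := h1 w hw.le
    have e2 := h2 w hw.ge
    have e3 : conj (1 - w) ≠ 0 := (map_ne_zero _).2 e1
    have e4 : conj (1 + w) ≠ 0 := (map_ne_zero _).2 e2
    have hsq : (1 + w) * conj (1 + w) = (R ^ 2 : ℝ) * ((1 - w) * conj (1 - w)) := by
      rw [mul_conj, mul_conj, normSq_eq_norm_sq, normSq_eq_norm_sq, hw]
      push_cast; ring
    have h3 : ((R ^ 2 : ℝ) : ℂ) * conj ((1 - w) / (1 + w)) = (1 + w) / (1 - w) := by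
      rw [map_div₀, mul_div_assoc', div_eq_div_iff e4 e1]
      linear_combination -hsq
    have h4 : normSq ((1 + w) / (1 - w)) = R ^ 2 := by
      rw [map_div₀, normSq_eq_norm_sq, normSq_eq_norm_sq, hw]
      have := norm_ne_zero_iff.2 e1
      field_simp
    rw [h3, hemi, h4, sub_self, Real.sqrt_zero, neg_zero]

theorem kap_snd_nonpos (R : ℝ) (w : ℂ) : (kap R w).2 ≤ 0 := by
  unfold kap
  split_ifs <;> simp [hemi]

/-- Only w = 0 is sent to the point 1, and -1 would be the image of ∞. All other values lie in the
plane off ±1 or on the hemisphere, which is beyond the reach of the lower arc. -/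
theorem kap_cases {R : ℝ} (hR : 0 < R) {w : ℂ} (hw : w ≠ 0) :
    ((kap R w).2 = 0 ∧ (kap R w).1 ≠ 1 ∧ (kap R w).1 ≠ -1) ∨ R ≤ taxi (kap R w) := by
  unfold kap
  split_ifs with h
  · left
    have h1 : 1 - w ≠ 0 := by
      intro h0
      rw [h0, norm_zero, mul_zero, norm_le_zero_iff] at h
      have : (2 : ℂ) = 0 := by linear_combination h + h0
      norm_num at this
    refine ⟨rfl, fun h2 => hw ?_, fun h2 => ?_⟩
    · replace h2 : (1 + w) / (1 - w) = 1 := h2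
      rw [div_eq_iff h1] at h2
      linear_combination h2 / 2
    · replace h2 : (1 + w) / (1 - w) = -1 := h2
      rw [div_eq_iff h1] at h2
      have : (2 : ℂ) = 0 := by linear_combination h2
      norm_num at this
  · right
    refine le_taxi_hemi ?_
    push Not at h
    have h1 : 0 < ‖1 + w‖ := lt_of_le_of_lt (by positivity) h
    rw [norm_mul, norm_real, Real.norm_of_nonneg (by positivity), RCLike.norm_conj, norm_div,
      mul_div_assoc', div_le_iff₀ h1]
    nlinarith

/-- This matches the two half-space formulas along the plane. Outside the disc of radius R, both
send c to the hemisphere point below its inversion R²c/|c|²; c = ∞, where `mob` tends to 1,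
corresponds to the bottom of the hemisphere. -/
theorem kap_mob {R : ℝ} (hR : 0 < R) {c : ℂ} (hc : c ≠ -1) : kap R (mob c) = rho R (c, 0) := by
  have h1 : c + 1 ≠ 0 := fun h => hc (eq_neg_of_add_eq_zero_left h)
  have e1 : 1 + mob c = 2 * c / (c + 1) := by unfold mob; field_simp; ring
  have e2 : 1 - mob c = 2 / (c + 1) := by unfold mob; field_simp; ring
  have hn : 0 < ‖c + 1‖ := norm_pos_iff.2 h1
  have hl : len (c, 0) = ‖c‖ := by simp [len, Complex.norm_def]
  have hiff : ‖1 + mob c‖ ≤ R * ‖1 - mob c‖ ↔ len (c, 0) ≤ R := by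
    rw [e1, e2, norm_div, norm_div, norm_mul, hl, mul_div_assoc', div_le_div_iff_of_pos_right hn]
    have : (0 : ℝ) < ‖(2 : ℂ)‖ := by simp
    rw [mul_comm R, mul_le_mul_iff_right₀ this]
  unfold kap rho
  simp only [hiff]
  split_ifs with h
  · rw [e1, e2]
    simp only [abs_zero, neg_zero, Prod.mk.injEq, and_true]
    field_simp
  · have hc0 : c ≠ 0 := by
      rintro rfl
      rw [hl, norm_zero] at h
      exact h hR.le
    have hcc : conj c ≠ 0 := (map_ne_zero _).2 hc0
    congr 1
    rw [e1, e2, div_div_div_cancel_right₀ h1, hl, ← normSq_eq_norm_sq]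
    push_cast
    rw [← mul_conj, map_div₀, map_mul]
    have : conj (2 : ℂ) = 2 := map_ofNat _ 2
    rw [this]
    field_simp

/-- The closed negative real axis pulls back under `mob` to the segment [-1, 1], its end -1 included
because division by zero gives 0. Hence `mob` has a continuous logarithm off the segment. -/
theorem mob_mem_slitPlane {c : ℂ} (hc : ¬ (c.im = 0 ∧ |c.re| ≤ 1)) : mob c ∈ slitPlane := by
  have h1 : c + 1 ≠ 0 := by
    intro h
    have : c = -1 := eq_neg_of_add_eq_zero_left h
    exact hc (by simp [this])
  have hn : 0 < normSq (c + 1) := normSq_pos.2 h1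
  have hre : (mob c).re = (normSq c - 1) / normSq (c + 1) := by
    rw [mob, div_re]
    simp only [normSq_apply, sub_re, add_re, one_re, sub_im, add_im, one_im]
    ring
  have him : (mob c).im = 2 * c.im / normSq (c + 1) := by
    rw [mob, div_im]
    simp only [normSq_apply, sub_re, add_re, one_re, sub_im, add_im, one_im]
    ring
  rw [mem_slitPlane_iff, hre, him]
  by_cases h : c.im = 0
  · left
    have h2 : 1 < |c.re| := by
      by_contra! h3; exact hc ⟨h, h3⟩
    refine div_pos ?_ hn
    rw [normSq_apply, h]
    nlinarith [sq_abs c.re, abs_nonneg c.re]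
  · right
    exact div_ne_zero (mul_ne_zero two_ne_zero h) hn.ne'

end KnotSum

/-! ### Lower and upper arcs: retraction and collapse -/

namespace KnotSum

open Complex ComplexConjugate

/-- The segment from `-1` to `1` in the plane at height zero. -/
def unitSeg : Set (ℂ × ℝ) := {p | p.2 = 0 ∧ p.1.im = 0 ∧ |p.1.re| ≤ 1}

/-- A closed subset of the lower half-space that meets the boundary plane in `1` and `-1` and has
taxicab size less than `R`. -/
structure IsLowerArc (A : Set (ℂ × ℝ)) (R : ℝ) : Prop where
  isClosed : IsClosed A
  snd_nonpos : ∀ p ∈ A, p.2 ≤ 0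
  plane : ∀ p ∈ A, p.2 = 0 → p.1 = 1 ∨ p.1 = -1
  one_mem : ((1 : ℂ), (0 : ℝ)) ∈ A
  neg_one_mem : ((-1 : ℂ), (0 : ℝ)) ∈ A
  taxi_lt : ∀ p ∈ A, taxi p < R

/-- A closed subset of the upper half-space that meets the boundary plane in `1` and `-1` and in
which no separation splits these points. -/
structure IsUpperArc (A : Set (ℂ × ℝ)) : Prop where
  isClosed : IsClosed A
  snd_nonneg : ∀ p ∈ A, 0 ≤ p.2
  plane : ∀ p ∈ A, p.2 = 0 → p.1 = 1 ∨ p.1 = -1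
  one_mem : ((1 : ℂ), (0 : ℝ)) ∈ A
  neg_one_mem : ((-1 : ℂ), (0 : ℝ)) ∈ A
  not_separated : ∀ M N : Set (ℂ × ℝ), IsClosed M → IsClosed N → Disjoint M N → M ∪ N = A →
    ((-1 : ℂ), (0 : ℝ)) ∈ M → ((1 : ℂ), (0 : ℝ)) ∉ N

/-- Move a point down by half of its distance to `A`. -/
noncomputable def lower (A : Set (ℂ × ℝ)) (p : ℂ × ℝ) : ℂ × ℝ :=
  (p.1, p.2 - Metric.infDist p A / 2)

theorem continuous_lower (A : Set (ℂ × ℝ)) : Continuous (lower A) := by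
  have := Metric.continuous_infDist_pt A
  unfold lower
  fun_prop

theorem isClosed_unitSeg : IsClosed unitSeg := by
  refine (isClosed_eq continuous_snd continuous_const).inter
    ((isClosed_eq (f := fun p : ℂ × ℝ => p.1.im) (by fun_prop) continuous_const).inter
    (isClosed_le (f := fun p : ℂ × ℝ => |p.1.re|) (by fun_prop) continuous_const))

variable {A B : Set (ℂ × ℝ)} {R : ℝ}

namespace IsLowerArc

theorem one_lt (hA : IsLowerArc A R) : 1 < R := by
  simpa [taxi] using hA.taxi_lt _ hA.one_mem

theorem taxi_lt_of_mem (hA : IsLowerArc A R) {p : ℂ × ℝ} (hp : p ∈ A ∪ unitSeg) : taxi p < R := by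
  rcases hp with hp | ⟨h1, h2, h3⟩
  · exact hA.taxi_lt p hp
  · refine lt_of_le_of_lt ?_ hA.one_lt
    have : p.1 = (p.1.re : ℂ) := Complex.ext rfl (by simpa using h2)
    rw [taxi, h1, abs_zero, add_zero, this, norm_real]
    exact h3

theorem snd_nonpos_of_mem (hA : IsLowerArc A R) {p : ℂ × ℝ} (hp : p ∈ A ∪ unitSeg) : p.2 ≤ 0 := by
  rcases hp with hp | hp
  · exact hA.snd_nonpos p hp
  · exact hp.1.le

theorem isClosed_union (hA : IsLowerArc A R) : IsClosed (A ∪ unitSeg) :=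
  hA.isClosed.union isClosed_unitSeg

theorem infDist_pos (hA : IsLowerArc A R) {p : ℂ × ℝ} (hp : p ∉ A) : 0 < Metric.infDist p A :=
  (hA.isClosed.notMem_iff_infDist_pos ⟨_, hA.one_mem⟩).1 hp

/-- Moving down by a positive amount less than the distance to `A` leads off the closed curve. -/
theorem down_notMem {p : ℂ × ℝ} (hz : p.2 ≤ 0) {s : ℝ} (hs : 0 < s)
    (hsd : s < Metric.infDist p A) : (p.1, p.2 - s) ∉ A ∪ unitSeg := by
  rintro (h | h)
  · have h1 := Metric.infDist_le_dist_of_mem (x := p) h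
    rw [Prod.dist_eq] at h1
    simp only [dist_self, Real.dist_eq, sub_sub_cancel, abs_of_pos hs] at h1
    rw [max_eq_right hs.le] at h1
    linarith
  · have h1 : p.2 - s = 0 := h.1
    linarith

theorem lower_notMem (hA : IsLowerArc A R) {p : ℂ × ℝ} (hz : p.2 ≤ 0) (hp : p ∉ A) :
    lower A p ∉ A ∪ unitSeg := by
  have := hA.infDist_pos hp
  exact down_notMem hz (by linarith) (by linarith)

theorem notMem_of_le_taxi (hA : IsLowerArc A R) {p : ℂ × ℝ} (hp : R ≤ taxi p) :
    p ∉ A ∪ unitSeg :=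
  fun h => (hA.taxi_lt_of_mem h).not_ge hp

theorem rho_notMem (hA : IsLowerArc A R) {p : ℂ × ℝ} (hz : p.2 ≤ 0) (hp : p ∉ A) :
    rho R p ∉ A := by
  by_cases h : len p ≤ R
  · rwa [rho_of_len_le hz h]
  · exact fun hm => hA.notMem_of_le_taxi
      (rho_of_lt_len (zero_lt_one.trans hA.one_lt) (not_le.1 h)).1 (Or.inl hm)

theorem kap_notMem (hA : IsLowerArc A R) {w : ℂ} (hw : w ≠ 0) : kap R w ∉ A := by
  intro hm
  rcases kap_cases (zero_lt_one.trans hA.one_lt) hw with ⟨h0, h1, h2⟩ | h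
  · exact (hA.plane _ hm h0).elim h1 h2
  · exact hA.notMem_of_le_taxi h (Or.inl hm)

/-- The straight segment from a point `p` of the lower half-space to `lower A (rho R p)` avoids the
closed curve. -/
theorem homotopy_notMem (hA : IsLowerArc A R) {p : ℂ × ℝ} (hz : p.2 ≤ 0) (hp : p ∉ A ∪ unitSeg)
    {t : ℝ} (ht0 : 0 ≤ t) (ht1 : t ≤ 1) :
    p + t • (lower A (rho R p) - p) ∉ A ∪ unitSeg := by
  have hpA : p ∉ A := fun h => hp (Or.inl h)
  by_cases h : len p ≤ R
  · rw [rho_of_len_le hz h]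
    have e : p + t • (lower A p - p) = (p.1, p.2 - t * (Metric.infDist p A / 2)) := by
      ext1
      · simp [lower]
      · simp [lower]; ring
    rw [e]
    have hd := hA.infDist_pos hpA
    rcases ht0.eq_or_lt with rfl | ht
    · simpa using hp
    · exact down_notMem hz (by positivity) (by nlinarith)
  · push Not at h
    obtain ⟨h1, s, hs, h2⟩ := rho_of_lt_len (zero_lt_one.trans hA.one_lt) h
    have h3 := rho_snd_nonpos R p
    have hd : 0 ≤ Metric.infDist (rho R p) A := Metric.infDist_nonneg
    have h4 := h.le.trans (len_le_taxi p)
    -- The horizontal parts of both ends lie on one ray from 0 and both heights are nonpositive, so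
    -- `taxi` is affine along the segment and stays at least R. This is the reason for the taxicab
    -- length.
    refine hA.notMem_of_le_taxi ?_
    have e1 : (p + t • (lower A (rho R p) - p)).1 = ((1 - t + t * s : ℝ) : ℂ) * p.1 := by
      simp [lower, h2]; ring
    have e2 : (p + t • (lower A (rho R p) - p)).2
        = (1 - t) * p.2 + t * ((rho R p).2 - Metric.infDist (rho R p) A / 2) := by
      simp [lower]; ring
    have hts : 0 ≤ t * s := mul_nonneg ht0 hs
    have h5 : (p + t • (lower A (rho R p) - p)).2 ≤ 0 := by rw [e2]; nlinarith
    rw [taxi, abs_of_nonpos h5, e1, norm_mul, norm_real, Real.norm_of_nonneg (by linarith), e2]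
    rw [taxi, h2, abs_of_nonpos h3, norm_mul, norm_real, Real.norm_of_nonneg hs] at h1
    rw [taxi, abs_of_nonpos hz] at h4
    nlinarith [mul_le_mul_of_nonneg_left h1 ht0, mul_le_mul_of_nonneg_left h4 (sub_nonneg.2 ht1),
      mul_nonneg ht0 hd]

/-- A map of a compact space into the complement of the union of a lower and an upper arc can be
changed over the upper half-space to a map into the complement of the lower arc closed by the
segment. -/
theorem exists_retract (hA : IsLowerArc A R) (hB : IsUpperArc B) {T : Type*} [TopologicalSpace T]
    [CompactSpace T] [T2Space T] (h : C(T, ℂ × ℝ)) (hX : ∀ t, h t ∉ A ∪ B) :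
    ∃ r : C(T, ℂ × ℝ), (∀ t, r t ∉ A ∪ unitSeg) ∧
      ∀ t, (h t).2 ≤ 0 → r t = lower A (rho R (h t)) := by
  have hR : 0 < R := zero_lt_one.trans hA.one_lt
  have hdisj : Disjoint (Set.range h) B := by
    rw [Set.disjoint_left]
    rintro _ ⟨t, rfl⟩ hm
    exact hX t (Or.inr hm)
  -- Compactness gives one step length δ for the whole image of `h`.
  obtain ⟨δ, hδ, hd⟩ :=
    Metric.exists_pos_forall_lt_edist (isCompact_range h.continuous) hB.isClosed hdisj
  let D : Set T := {t | 0 ≤ (h t).2}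
  have hD : IsClosed D := isClosed_le continuous_const (continuous_snd.comp h.continuous)
  have : CompactSpace D := isCompact_iff_compactSpace.1 hD.isCompact
  obtain ⟨S, hS0, hS⟩ := exists_extension_mob (T := D) (h := fun t => h t)
    (h.continuous.comp continuous_subtype_val) (fun t => t.2) hB.snd_nonneg (δ := δ)
    (by exact_mod_cast hδ)
    (by
      intro t q hq
      have h1 := (hd (h t) ⟨t, rfl⟩ q hq).le
      rw [edist_comm, edist_nndist] at h1
      exact_mod_cast h1)
    hB.neg_one_mem hB.one_mem
    (exists_chain hB.isClosed hB.neg_one_mem hB.one_mem hB.not_separated (by exact_mod_cast hδ))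
  -- The extension may vanish off `D`, but the values of the map built below use it only on `D`.
  obtain ⟨S', hS'⟩ := S.exists_restrict_eq hD
  have hSS : ∀ t (ht : t ∈ D), S' t = S ⟨t, ht⟩ := fun t ht => DFunLike.congr_fun hS' ⟨t, ht⟩
  have hrho := continuous_rho hR
  have hkap := continuous_kap hR
  have hlow := continuous_lower A
  refine ⟨⟨fun t => if (h t).2 ≤ 0 then lower A (rho R (h t)) else lower A (kap R (S' t)), ?_⟩,
    ?_, ?_⟩
  · refine Continuous.if_le (by fun_prop) (by fun_prop) (by fun_prop) continuous_const ?_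
    intro t ht
    have htD : t ∈ D := ht.ge
    have hne : (h t).1 ≠ -1 := fun h1 => hX t (Or.inl (by
      have : h t = (-1, 0) := Prod.ext h1 ht
      rw [this]; exact hA.neg_one_mem))
    have e1 : S ⟨t, htD⟩ = mob (h t).1 := hS ⟨t, htD⟩ ht
    have e2 : h t = ((h t).1, 0) := Prod.ext rfl ht
    rw [hSS t htD, e1, kap_mob hR hne, ← e2]
  · intro t
    simp only [ContinuousMap.coe_mk]
    split_ifs with ht
    · exact hA.lower_notMem (rho_snd_nonpos _ _)
        (hA.rho_notMem ht fun hm => hX t (Or.inl hm))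
    · have htD : t ∈ D := (not_le.1 ht).le
      refine hA.lower_notMem (kap_snd_nonpos _ _) (hA.kap_notMem ?_)
      rw [hSS t htD]
      exact hS0 _
  · intro t ht
    simp only [ContinuousMap.coe_mk, if_pos ht]

/-- The complement of the closed curve maps to the lower half-space away from the lower arc, by
`rho` on the lower half-space. -/
theorem exists_collapse (hA : IsLowerArc A R) :
    ∃ e : C(↥(A ∪ unitSeg)ᶜ, ℂ × ℝ), (∀ y, (e y).2 ≤ 0 ∧ e y ∉ A) ∧
      ∀ y : ↥(A ∪ unitSeg)ᶜ, y.1.2 ≤ 0 → e y = rho R y := by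
  have hR : 0 < R := zero_lt_one.trans hA.one_lt
  let P : Set ↥(A ∪ unitSeg)ᶜ := {y | y.1.2 = 0}
  have hP : IsClosed P := isClosed_eq (by fun_prop) continuous_const
  have hseg : ∀ y : P, mob y.1.1.1 ∈ slitPlane := fun y =>
    mob_mem_slitPlane fun h => y.1.2 (Or.inr ⟨y.2, h⟩)
  have hne : ∀ y : P, y.1.1.1 ≠ -1 := fun y h => y.1.2 (Or.inl (by
    have : (y : ↥(A ∪ unitSeg)ᶜ).1 = (-1, 0) := Prod.ext h y.2
    rw [this]; exact hA.neg_one_mem))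
  let l : C(P, ℂ) := ⟨fun y => log (mob y.1.1.1), by
    refine Continuous.clog ?_ hseg
    unfold mob
    refine Continuous.div (by fun_prop) (by fun_prop) fun y h => ?_
    exact hne y (eq_neg_of_add_eq_zero_left h)⟩
  -- Extending the logarithm instead of `mob` itself ensures that exp (L y) is never zero.
  obtain ⟨L, hL⟩ := l.exists_restrict_eq hP
  have hrho := continuous_rho hR
  have hkap := continuous_kap hR
  refine ⟨⟨fun y => if y.1.2 ≤ 0 then rho R y else kap R (exp (L y)), ?_⟩, ?_, ?_⟩
  · refine Continuous.if_le (by fun_prop) (by fun_prop) (by fun_prop) continuous_const ?_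
    intro y hy
    have hLy : L y = log (mob y.1.1) := DFunLike.congr_fun hL (⟨y, hy⟩ : P)
    have e2 : y.1 = (y.1.1, 0) := Prod.ext rfl hy
    rw [hLy, exp_log (slitPlane_ne_zero (hseg ⟨y, hy⟩)), kap_mob hR (hne ⟨y, hy⟩), ← e2]
  · intro y
    simp only [ContinuousMap.coe_mk]
    split_ifs with hy
    · exact ⟨rho_snd_nonpos _ _, hA.rho_notMem hy fun hm => y.2 (Or.inl hm)⟩
    · exact ⟨kap_snd_nonpos _ _, hA.kap_notMem (exp_ne_zero _)⟩
  · intro y hy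
    simp only [ContinuousMap.coe_mk, if_pos hy]

end IsLowerArc

end KnotSum

/-! ### A criterion for detecting null-homotopic loops -/

namespace KnotSum

open scoped unitInterval

/-- A map that sends only null-homotopic loops to null-homotopic loops. -/
def DetectsLoops {X Y : Type*} [TopologicalSpace X] [TopologicalSpace Y] (e : C(X, Y)) : Prop :=
  ∀ (x : X) (γ : Path x x), (γ.map e.continuous).Homotopic (Path.refl (e x)) →
    γ.Homotopic (Path.refl x)

variable {X : Type*} [TopologicalSpace X]

/-- A property of homotopy classes of paths that is closed under composition and holds for the paths
in each of two open sets that cover the space holds for all paths. -/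
theorem path_class_induction {U V : Set X} (hU : IsOpen U) (hV : IsOpen V)
    (hUV : ∀ x, x ∈ U ∨ x ∈ V) (P : ∀ x y : X, Path.Homotopic.Quotient x y → Prop)
    (htrans : ∀ (x y z : X) (p : Path.Homotopic.Quotient x y) (q : Path.Homotopic.Quotient y z),
      P x y p → P y z q → P x z (p.trans q))
    (hPU : ∀ (x y : X) (p : Path x y), (∀ t, p t ∈ U) → P x y (.mk p))
    (hPV : ∀ (x y : X) (p : Path x y), (∀ t, p t ∈ V) → P x y (.mk p))
    {x y : X} (p : Path x y) : P x y (.mk p) := by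
  obtain ⟨t, ht0, hmono, ⟨n, hn⟩, ht⟩ := exists_monotone_Icc_subset_open_cover_unitInterval
    (c := fun i : Bool => p ⁻¹' (if i then U else V))
    (by rintro (_ | _)
        · exact hV.preimage p.continuous
        · exact hU.preimage p.continuous)
    (by intro s _
        rcases hUV (p s) with h | h
        · exact Set.mem_iUnion.2 ⟨true, h⟩
        · exact Set.mem_iUnion.2 ⟨false, h⟩)
  have hstep : ∀ k, P _ _ (.mk (p.subpath (t k) (t (k + 1)))) := by
    intro k
    obtain ⟨i, hi⟩ := ht k
    have hr : ∀ s, p.subpath (t k) (t (k + 1)) s ∈ p '' Set.Icc (t k) (t (k + 1)) := by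
      intro s
      rw [← Path.range_subpath_of_le p _ _ (hmono k.le_succ)]
      exact ⟨s, rfl⟩
    cases i with
    | true =>
      refine hPU _ _ _ fun s => ?_
      obtain ⟨r, hr1, hr2⟩ := hr s
      rw [← hr2]; exact hi hr1
    | false =>
      refine hPV _ _ _ fun s => ?_
      obtain ⟨r, hr1, hr2⟩ := hr s
      rw [← hr2]; exact hi hr1
  have hrefl : ∀ x, P x x (.mk (Path.refl x)) := by
    intro x
    rcases hUV x with h | h
    · exact hPU _ _ _ fun _ => h
    · exact hPV _ _ _ fun _ => h
  have hall : ∀ k, P _ _ (.mk (p.subpath (t 0) (t k))) := by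
    intro k
    induction k with
    | zero => rw [Path.subpath_self]; exact hrefl _
    | succ k ih =>
      have := htrans _ _ _ _ _ ih (hstep k)
      rwa [← Path.Homotopic.Quotient.mk_trans,
        Path.Homotopic.Quotient.eq.2 ⟨Path.Homotopy.subpathTransSubpath p _ _ _⟩] at this
  have h1 := hall n
  rw [ht0, hn n le_rfl, Path.subpath_zero_one] at h1
  have hcast : ∀ {a b a' b' : X} (q : Path a b) (ha : a' = a) (hb : b' = b),
      P a' b' (.mk (q.cast ha hb)) → P a b (.mk q) := by
    rintro a b _ _ q rfl rfl h
    exact h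
  exact hcast p _ _ h1

theorem joinedIn_subtype {E : Type*} [TopologicalSpace E] {S : Set E} {F : Set E} {x y : S}
    (h : JoinedIn (S ∩ F) x.1 y.1) : JoinedIn (Subtype.val ⁻¹' F : Set S) x y := by
  rw [← Topology.IsInducing.subtypeVal.joinedIn_image h.source_mem.2 h.target_mem.2,
    Subtype.image_preimage_coe]
  exact h

/-- The part `L` of the space carries all loops, as soon as the rest of the space lies in an open
set `V` whose paths are determined by their ends up to homotopy and which meets `L` in a path
connected set. Hence a self-map of the space which is homotopic to the identity over `L` detects
null-homotopic loops. -/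
theorem detectsLoops_of_homotopy {U V L : Set X} (hU : IsOpen U) (hV : IsOpen V)
    (hUV : ∀ x, x ∈ U ∨ x ∈ V) (hUL : U ⊆ L)
    (hb : ∀ x, ∃ b ∈ L, ∃ τ : Path x b, (x ∈ V → ∀ t, τ t ∈ V) ∧ (x ∈ L → ∀ t, τ t ∈ L))
    (hVL : ∀ b ∈ V ∩ L, ∀ c ∈ V ∩ L, JoinedIn (V ∩ L) b c)
    (hVs : ∀ (x y : X) (p q : Path x y), (∀ t, p t ∈ V) → (∀ t, q t ∈ V) → p.Homotopic q)
    (g : C(X, X)) (i : C(L, X)) (hi : ∀ l, i l = l) (F : i.Homotopy (g.comp i)) :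
    DetectsLoops g := by
  intro x γ hγ
  obtain rfl : i = ⟨Subtype.val, continuous_subtype_val⟩ := by ext l; exact hi l
  choose b hbL τ hτV hτL using hb
  have trans_mem : ∀ {S : Set X} {x y z : X} {p : Path x y} {q : Path y z}, (∀ t, p t ∈ S) →
      (∀ t, q t ∈ S) → ∀ t, p.trans q t ∈ S := by
    intro S x y z p q hp hq t
    rw [Path.trans_apply]
    split_ifs
    · exact hp _
    · exact hq _
  have symm_mem : ∀ {S : Set X} {x y : X} {p : Path x y}, (∀ t, p t ∈ S) → ∀ t, p.symm t ∈ S :=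
    fun hp t => hp _
  -- After conjugation by the paths `τ`, every path class has a representative in `L`. This property
  -- is multiplicative, so pieces in `U` or `V` suffice; a piece in `V` is replaced by a path in `V
  -- ∩ L` with the same ends.
  obtain ⟨p, hpL, hp⟩ : ∃ p : Path (b x) (b x), (∀ t, p t ∈ L) ∧
      (((τ x).symm.trans γ).trans (τ x)).Homotopic p := by
    have := path_class_induction hU hV hUV
      (fun x y q => ∃ p : Path (b x) (b y), (∀ t, p t ∈ L) ∧
        ((Path.Homotopic.Quotient.mk (τ x)).symm.trans q).trans (.mk (τ y)) = .mk p)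
      ?_ ?_ ?_ γ
    · obtain ⟨p, h1, h2⟩ := this
      exact ⟨p, h1, Path.Homotopic.Quotient.exact h2⟩
    · rintro x y z q r ⟨p, h1, h2⟩ ⟨p', h1', h2'⟩
      refine ⟨p.trans p', trans_mem h1 h1', ?_⟩
      rw [Path.Homotopic.Quotient.mk_trans, ← h2, ← h2']
      simp only [Path.Homotopic.Quotient.trans_assoc]
      rw [← Path.Homotopic.Quotient.trans_assoc (.mk (τ y)), Path.Homotopic.Quotient.trans_symm,
        Path.Homotopic.Quotient.refl_trans]
    · intro x y p hp
      have hx : x ∈ L := hUL (by simpa using hp 0)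
      have hy : y ∈ L := hUL (by simpa using hp 1)
      exact ⟨((τ x).symm.trans p).trans (τ y),
        trans_mem (trans_mem (symm_mem (hτL x hx)) fun t => hUL (hp t)) (hτL y hy), rfl⟩
    · intro x y p hp
      have hx : x ∈ V := by simpa using hp 0
      have hy : y ∈ V := by simpa using hp 1
      have hbx : b x ∈ V := by simpa using hτV x hx 1
      have hby : b y ∈ V := by simpa using hτV y hy 1
      obtain ⟨q, hq⟩ := hVL (b x) ⟨hbx, hbL x⟩ (b y) ⟨hby, hbL y⟩
      refine ⟨q, fun t => (hq t).2, ?_⟩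
      exact Path.Homotopic.Quotient.eq.2 (hVs _ _ _ q
        (trans_mem (trans_mem (symm_mem (hτV x hx)) hp) (hτV y hy)) fun t => (hq t).1)
  have hpg : (p.map g.continuous).Homotopic (Path.refl _) := by
    refine (hp.map g).symm.trans ?_
    rw [Path.map_trans, Path.map_trans, ← Path.Homotopic.Quotient.eq]
    simp only [Path.Homotopic.Quotient.mk_trans, Path.Homotopic.Quotient.eq.2 hγ,
      Path.Homotopic.Quotient.mk_refl, Path.Homotopic.Quotient.trans_refl, ← Path.map_symm,
      Path.Homotopic.Quotient.mk_symm, Path.Homotopic.Quotient.symm_trans]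
  let p' : Path (⟨b x, hbL x⟩ : L) ⟨b x, hbL x⟩ :=
    { toFun := fun t => ⟨p t, hpL t⟩
      continuous_toFun := by fun_prop
      source' := by simp
      target' := by simp }
  -- The track of the base point under `F` conjugates `p` to its image under `g`, which is
  -- null-homotopic.
  have hnat := Path.Homotopic.map_trans_evalAt F p'
  have hp1 : p.Homotopic (Path.refl _) := by
    rw [← Path.Homotopic.Quotient.eq] at hnat hpg ⊢
    have e1 : p'.map (map_continuous (⟨Subtype.val, continuous_subtype_val⟩ : C(L, X))) = p := rfl
    have e2 : p'.map (map_continuous (g.comp (⟨Subtype.val, continuous_subtype_val⟩ : C(L, X))))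
      = p.map g.continuous := rfl
    rw [e1, e2] at hnat
    simp only [Path.Homotopic.Quotient.mk_trans] at hnat
    have hpg' : Path.Homotopic.Quotient.mk (p.map g.continuous) = .refl _ := hpg
    have h3 := congrArg (fun q => q.trans (Path.Homotopic.Quotient.mk (F.evalAt ⟨b x, hbL x⟩)).symm)
      hnat
    simp only [Path.Homotopic.Quotient.trans_assoc] at h3
    rw [Path.Homotopic.Quotient.trans_symm] at h3
    erw [hpg', Path.Homotopic.Quotient.refl_trans, Path.Homotopic.Quotient.trans_refl,
      Path.Homotopic.Quotient.trans_symm] at h3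
    exact h3
  have h4 := Path.Homotopic.Quotient.eq.2 (hp.trans hp1)
  simp only [Path.Homotopic.Quotient.mk_trans, Path.Homotopic.Quotient.mk_symm,
    Path.Homotopic.Quotient.mk_refl] at h4
  rw [← Path.Homotopic.Quotient.eq, Path.Homotopic.Quotient.mk_refl]
  have h5 := congrArg (fun q => ((Path.Homotopic.Quotient.mk (τ x)).trans q).trans
    (Path.Homotopic.Quotient.mk (τ x)).symm) h4
  simpa only [← Path.Homotopic.Quotient.trans_assoc, Path.Homotopic.Quotient.trans_symm,
    Path.Homotopic.Quotient.refl_trans, Path.Homotopic.Quotient.trans_refl,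
    Path.Homotopic.Quotient.trans_assoc (Path.Homotopic.Quotient.mk γ)] using h5

end KnotSum

/-! ### The shadow of the lower curve and the injection of loops -/

namespace KnotSum

open scoped unitInterval Pointwise
open Complex

variable {A B : Set (ℂ × ℝ)} {R : ℝ}

/-- The points on or vertically below `K`. -/
def shadow (K : Set (ℂ × ℝ)) : Set (ℂ × ℝ) := {p | ∃ s : ℝ, 0 ≤ s ∧ (p.1, p.2 + s) ∈ K}

theorem subset_shadow (K : Set (ℂ × ℝ)) : K ⊆ shadow K := fun p hp => ⟨0, le_rfl, by simpa using hp⟩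

theorem up_notMem_shadow {K : Set (ℂ × ℝ)} {p : ℂ × ℝ} (hp : p ∉ shadow K) {s : ℝ} (hs : 0 ≤ s) :
    (p.1, p.2 + s) ∉ shadow K := by
  rintro ⟨r, hr, h⟩
  exact hp ⟨s + r, add_nonneg hs hr, by rwa [← add_assoc]⟩

theorem isClosed_shadow {K : Set (ℂ × ℝ)} (hK : IsCompact K) : IsClosed (shadow K) := by
  have h1 : IsClosed {p : ℂ × ℝ | p.1 = 0 ∧ p.2 ≤ 0} :=
    (isClosed_eq continuous_fst continuous_const).inter
      (isClosed_le continuous_snd continuous_const)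
  have h2 : shadow K = K + {p : ℂ × ℝ | p.1 = 0 ∧ p.2 ≤ 0} := by
    ext p
    rw [Set.mem_add]
    constructor
    · rintro ⟨s, hs, h⟩
      exact ⟨_, h, (0, -s), ⟨rfl, by simpa using hs⟩, by ext1 <;> simp⟩
    · rintro ⟨q, hq, r, ⟨hr1, hr2⟩, rfl⟩
      refine ⟨-r.2, by linarith, ?_⟩
      have : ((q + r).1, (q + r).2 + -r.2) = q := by ext1 <;> simp [hr1]
      rwa [this]
  rw [h2]
  exact h1.add_left_of_isCompact hK

namespace IsLowerArc

theorem isCompact_union (hA : IsLowerArc A R) : IsCompact (A ∪ unitSeg) := by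
  refine Metric.isCompact_of_isClosed_isBounded hA.isClosed_union ?_
  refine (Metric.isBounded_closedBall (x := (0 : ℂ × ℝ)) (r := R)).subset fun p hp => ?_
  have h := (hA.taxi_lt_of_mem hp).le
  rw [mem_closedBall_zero_iff, Prod.norm_def, max_le_iff, Real.norm_eq_abs]
  unfold taxi at h
  exact ⟨by linarith [abs_nonneg p.2], by linarith [norm_nonneg p.1]⟩

theorem notMem_shadow_of_pos (hA : IsLowerArc A R) {p : ℂ × ℝ} (hp : 0 < p.2) :
    p ∉ shadow (A ∪ unitSeg) := by
  rintro ⟨s, hs, h⟩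
  have := hA.snd_nonpos_of_mem h
  simp only at this
  linarith

theorem notMem_shadow_of_plane (hA : IsLowerArc A R) {p : ℂ × ℝ} (hp0 : p.2 = 0)
    (hp : p ∉ A ∪ unitSeg) : p ∉ shadow (A ∪ unitSeg) := by
  rintro ⟨s, hs, h⟩
  have h2 := hA.snd_nonpos_of_mem h
  simp only [hp0, zero_add] at h2 h
  obtain rfl : s = 0 := le_antisymm h2 hs
  exact hp (by rwa [← hp0] at h)

theorem notMem_of_plane (hA : IsLowerArc A R) {c : ℂ} (hc : ¬ (c.im = 0 ∧ |c.re| ≤ 1)) :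
    (c, (0 : ℝ)) ∉ A ∪ unitSeg := by
  rintro (h | h)
  · rcases hA.plane _ h rfl with h1 | h1 <;> simp only at h1 <;> exact hc (by simp [h1])
  · exact hc h.2

/-- Raising a point never leads into the shadow, so everything can be lifted to positive height and
then contracted linearly in the convex upper half-space. -/
theorem contractibleSpace_compl_shadow (hA : IsLowerArc A R) :
    ContractibleSpace ↥(shadow (A ∪ unitSeg))ᶜ := by
  rw [contractible_iff_id_nullhomotopic]
  let S := shadow (A ∪ unitSeg)
  let up : C(↥Sᶜ, ↥Sᶜ) := ⟨fun p => ⟨(p.1.1, p.1.2 + (|p.1.2| + 1)),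
    up_notMem_shadow p.2 (by positivity)⟩, by fun_prop⟩
  have hup : ∀ p : ↥Sᶜ, 0 < p.1.2 + (|p.1.2| + 1) := fun p => by
    have := neg_abs_le p.1.2; linarith
  let c : ↥Sᶜ := ⟨(0, 1), hA.notMem_shadow_of_pos one_pos⟩
  refine ⟨c, ?_⟩
  have h1 : (ContinuousMap.id ↥Sᶜ).Homotopic up :=
    ⟨{ toFun := fun t => ⟨(t.2.1.1, t.2.1.2 + t.1 * (|t.2.1.2| + 1)),
        up_notMem_shadow t.2.2 (mul_nonneg t.1.2.1 (by positivity))⟩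
       continuous_toFun := by fun_prop
       map_zero_left := fun p => by simp
       map_one_left := fun p => by simp [up] }⟩
  have h2 : up.Homotopic (ContinuousMap.const _ c) :=
    ⟨{ toFun := fun t => ⟨((1 - t.1 : ℝ) • (up t.2).1.1,
          (1 - t.1 : ℝ) * (up t.2).1.2 + t.1 * 1), hA.notMem_shadow_of_pos (by
            have h0 := t.1.2.1
            have h1 := t.1.2.2
            have h2 : 0 < (up t.2).1.2 := hup t.2
            simp only [mul_one]
            rcases h0.eq_or_lt with h | h
            · rw [← h]; linarith
            · have := mul_nonneg (sub_nonneg.2 h1) h2.le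
              linarith)⟩
       continuous_toFun := by fun_prop
       map_zero_left := fun p => by simp
       map_one_left := fun p => by simp [c] }⟩
  exact h1.trans h2

/-- Outside the shadow, every point of the lower half-space can be joined to a fixed point. -/
theorem joinedIn_lower (hA : IsLowerArc A R) {p : ℂ × ℝ} (hz : p.2 ≤ 0)
    (hp : p ∉ shadow (A ∪ unitSeg)) :
    JoinedIn ((shadow (A ∪ unitSeg))ᶜ ∩ {q | q.2 ≤ 0}) p (2, 0) := by
  have hplane : ∀ c : ℂ, ¬ (c.im = 0 ∧ |c.re| ≤ 1) →
      (c, (0 : ℝ)) ∈ (shadow (A ∪ unitSeg))ᶜ ∩ {q : ℂ × ℝ | q.2 ≤ 0} :=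
    fun c hc => ⟨hA.notMem_shadow_of_plane rfl (hA.notMem_of_plane hc), le_refl (0 : ℝ)⟩
  have hseg : ∀ c d : ℂ, (∀ t : ℝ, 0 ≤ t → t ≤ 1 → ¬ ((c + t * (d - c)).im = 0 ∧
      |(c + t * (d - c)).re| ≤ 1)) →
      JoinedIn ((shadow (A ∪ unitSeg))ᶜ ∩ {q | q.2 ≤ 0}) (c, (0 : ℝ)) (d, 0) := by
    intro c d h
    refine JoinedIn.of_segment_subset ?_
    rw [segment_eq_image']
    rintro _ ⟨t, ⟨ht0, ht1⟩, rfl⟩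
    convert! hplane _ (h t ht0 ht1) using 1
    ext1 <;> simp
  have him : ∀ c : ℂ, c.im ≠ 0 →
      JoinedIn ((shadow (A ∪ unitSeg))ᶜ ∩ {q | q.2 ≤ 0}) (c, (0 : ℝ)) (2, 0) := by
    intro c hc
    refine hseg c 2 fun t ht0 ht1 h => ?_
    obtain ⟨h1, h2⟩ := h
    have h1' : (1 - t) * c.im = 0 := by
      simp at h1; linarith
    rcases mul_eq_zero.1 h1' with h3 | h3
    · obtain rfl : t = 1 := by linarith
      norm_num at h2
    · exact hc h3
  have hup : JoinedIn ((shadow (A ∪ unitSeg))ᶜ ∩ {q | q.2 ≤ 0}) p (p.1, 0) := by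
    refine JoinedIn.of_segment_subset ?_
    rw [segment_eq_image']
    rintro _ ⟨t, ⟨ht0, ht1⟩, rfl⟩
    have e : p + t • ((p.1, (0 : ℝ)) - p) = (p.1, p.2 + t * (-p.2)) := by ext1 <;> simp
    simp only [e]
    exact ⟨up_notMem_shadow hp (mul_nonneg ht0 (neg_nonneg.2 hz)),
      show p.2 + t * (-p.2) ≤ 0 by nlinarith⟩
  refine hup.trans ?_
  by_cases hc : p.1.im = 0
  · have hm := hup.target_mem.1
    have h1 : 1 < |p.1.re| := by
      by_contra! h
      exact hm (subset_shadow _ (Or.inr ⟨rfl, hc, h⟩))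
    rcases lt_abs.1 h1 with h | h
    · refine hseg _ _ fun t ht0 ht1 ⟨_, h3⟩ => ?_
      have h4 := (abs_le.1 h3).2
      simp at h4
      rcases ht0.eq_or_lt with rfl | ht
      · linarith
      · nlinarith [mul_nonneg (sub_nonneg.2 ht1) (sub_nonneg.2 h.le)]
    -- To the left of -1 the straight way to 2 is blocked by the segment; the detour leaves the real
    -- axis first.
    · refine (hseg p.1 (p.1 + Complex.I) fun t ht0 ht1 ⟨h2, h3⟩ => ?_).trans (him _ (by simp [hc]))
      have h4 := (abs_le.1 h3).1
      simp at h4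
      linarith
  · exact him _ hc

/-- A self-map of the complement of the closed curve given by `lower A ∘ rho R` on the lower
half-space detects null-homotopic loops. -/
theorem detectsLoops_of_rho (hA : IsLowerArc A R)
    (g : C(↥(A ∪ unitSeg)ᶜ, ↥(A ∪ unitSeg)ᶜ))
    (hg : ∀ y : ↥(A ∪ unitSeg)ᶜ, y.1.2 ≤ 0 → (g y).1 = lower A (rho R y)) :
    DetectsLoops g := by
  have hR : 0 < R := zero_lt_one.trans hA.one_lt
  let S := shadow (A ∪ unitSeg)
  let L : Set ↥(A ∪ unitSeg)ᶜ := {y | y.1.2 ≤ 0}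
  let V : Set ↥(A ∪ unitSeg)ᶜ := {y | y.1 ∉ S}
  let U : Set ↥(A ∪ unitSeg)ᶜ := {y | y.1.2 < 0}
  have hrho := continuous_rho hR
  have hlow := continuous_lower A
  let i : C(L, ↥(A ∪ unitSeg)ᶜ) := ⟨Subtype.val, continuous_subtype_val⟩
  let F : i.Homotopy (g.comp i) :=
    { toFun := fun t => ⟨t.2.1.1 + (t.1 : ℝ) • (lower A (rho R t.2.1.1) - t.2.1.1),
        hA.homotopy_notMem t.2.2 t.2.1.2 t.1.2.1 t.1.2.2⟩
      continuous_toFun := by fun_prop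
      map_zero_left := fun y => by simp [i]
      map_one_left := fun y => by
        ext1
        simpa [i] using (hg y.1 y.2).symm }
  have hbase : ((2 : ℂ), (0 : ℝ)) ∉ A ∪ unitSeg := hA.notMem_of_plane (by norm_num)
  have hbaseS : ((2 : ℂ), (0 : ℝ)) ∉ S := hA.notMem_shadow_of_plane rfl hbase
  have hcompl : ∀ p ∉ S, p ∉ A ∪ unitSeg := fun p hp h => hp (subset_shadow _ h)
  refine KnotSum.detectsLoops_of_homotopy (U := U) (V := V) (L := L)
    (isOpen_lt (by fun_prop) continuous_const)
    ((isClosed_shadow hA.isCompact_union).isOpen_compl.preimage continuous_subtype_val)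
    ?_ (fun y (hy : y.1.2 < 0) => show y.1.2 ≤ 0 from hy.le) ?_ ?_ ?_ g i (fun _ => rfl) F
  · intro y
    rcases lt_trichotomy y.1.2 0 with h | h | h
    · exact Or.inl h
    · exact Or.inr (hA.notMem_shadow_of_plane h y.2)
    · exact Or.inr (hA.notMem_shadow_of_pos h)
  · intro y
    by_cases hy : y.1.2 ≤ 0
    · exact ⟨y, hy, Path.refl y, fun h _ => h, fun h _ => h⟩
    · have hj : JoinedIn (Subtype.val ⁻¹' Sᶜ : Set ↥(A ∪ unitSeg)ᶜ) y ⟨(2, 0), hbase⟩ := by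
        refine joinedIn_subtype (JoinedIn.of_segment_subset ?_)
        rw [segment_eq_image']
        rintro _ ⟨t, ⟨ht0, ht1⟩, rfl⟩
        have : y.1 + t • (((2 : ℂ), (0 : ℝ)) - y.1) ∉ S := by
          rcases ht1.eq_or_lt with rfl | ht
          · simpa using hbaseS
          · refine hA.notMem_shadow_of_pos ?_
            simp only [Prod.snd_add, Prod.smul_snd, Prod.snd_sub, smul_eq_mul]
            push Not at hy
            nlinarith
        exact ⟨hcompl _ this, this⟩
      obtain ⟨τ, hτ⟩ := hj
      exact ⟨⟨(2, 0), hbase⟩, le_refl (0 : ℝ), τ, fun _ => hτ, fun h => absurd h hy⟩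
  · rintro ⟨b, hb⟩ ⟨hb1, hb2⟩ ⟨c, hc⟩ ⟨hc1, hc2⟩
    have h : JoinedIn (Sᶜ ∩ {q | q.2 ≤ 0}) b c :=
      (hA.joinedIn_lower hb2 hb1).trans (hA.joinedIn_lower hc2 hc1).symm
    exact joinedIn_subtype (F := Sᶜ ∩ {q | q.2 ≤ 0})
      (h.mono fun q hq => ⟨hcompl q hq.1, hq⟩)
  · intro x y p q hp hq
    have := hA.contractibleSpace_compl_shadow
    have hx : x ∈ V := by simpa using hp 0
    have hy : y ∈ V := by simpa using hp 1
    let lift : ∀ r : Path x y, (∀ t, r t ∈ V) → Path (⟨x.1, hx⟩ : ↥Sᶜ) ⟨y.1, hy⟩ := fun r hr =>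
      { toFun := fun t => ⟨(r t).1, hr t⟩
        continuous_toFun := by fun_prop
        source' := by simp
        target' := by simp }
    exact (SimplyConnectedSpace.paths_homotopic (lift p hp) (lift q hq)).map
      ⟨fun v : ↥Sᶜ => (⟨v.1, hcompl v.1 v.2⟩ : ↥(A ∪ unitSeg)ᶜ), by fun_prop⟩

/-- The complement of the closed lower curve maps to the complement of the union of the lower and
the upper arc by a map that detects null-homotopic loops. -/
theorem exists_detectsLoops (hA : IsLowerArc A R) (hB : IsUpperArc B) :
    ∃ e : C(↥(A ∪ unitSeg)ᶜ, ↥(A ∪ B)ᶜ), DetectsLoops e := by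
  have hR : 0 < R := zero_lt_one.trans hA.one_lt
  obtain ⟨e, he, hrho⟩ := hA.exists_collapse
  have hlowc := continuous_lower A
  have hrhoc := continuous_rho hR
  have hAB : ∀ p : ℂ × ℝ, p.2 ≤ 0 → p ∉ A → p ∉ A ∪ B := by
    rintro p hp hpA (h | h)
    · exact hpA h
    · have h0 : p.2 = 0 := le_antisymm hp (hB.snd_nonneg p h)
      refine hpA ?_
      rcases hB.plane p h h0 with h1 | h1
      · have : p = (1, 0) := Prod.ext h1 h0
        rw [this]; exact hA.one_mem
      · have : p = (-1, 0) := Prod.ext h1 h0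
        rw [this]; exact hA.neg_one_mem
  let e' : C(↥(A ∪ unitSeg)ᶜ, ↥(A ∪ B)ᶜ) :=
    ⟨fun y => ⟨e y, hAB _ (he y).1 (he y).2⟩, by fun_prop⟩
  let g : C(↥(A ∪ unitSeg)ᶜ, ↥(A ∪ unitSeg)ᶜ) :=
    ⟨fun y => ⟨lower A (rho R (e y)), hA.lower_notMem (rho_snd_nonpos _ _)
      (hA.rho_notMem (he y).1 (he y).2)⟩, by fun_prop⟩
  refine ⟨e', fun x γ ⟨H⟩ => hA.detectsLoops_of_rho g (fun y hy => ?_) x γ ?_⟩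
  · simp only [g, ContinuousMap.coe_mk, hrho y hy, rho_rho hR]
  · obtain ⟨r, hr, hrH⟩ := hA.exists_retract hB
      (⟨fun s => (H s).1, by fun_prop⟩ : C(I × I, ℂ × ℝ)) fun s => (H s).2
    -- On the boundary of the square, `H` takes values of `e'`, hence in the lower half-space, where
    -- `r` is `lower A ∘ rho R`. So `r` is a homotopy, relative to the ends, from the image of `γ`
    -- under `g` to a constant path.
    have key : ∀ (s : I × I) (y : ↥(A ∪ unitSeg)ᶜ), H s = e' y → r s = (g y).1 := by
      intro s y h
      have h1 : (H s).1 = e y := congrArg Subtype.val h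
      rw [hrH s (by simpa [h1] using (he y).1)]
      simp only [ContinuousMap.coe_mk, h1, g]
    refine ⟨{ toFun := fun s => ⟨r s, hr s⟩
              continuous_toFun := by fun_prop
              map_zero_left := fun t => Subtype.ext (key _ (γ t) (by simp))
              map_one_left := fun t => Subtype.ext (key _ x (by simp))
              prop' := ?_ }⟩
    rintro t s (rfl | rfl)
    · refine Subtype.ext ?_
      have := key (t, 0) x (by simp)
      simpa using this
    · refine Subtype.ext ?_
      have := key (t, 1) x (by simp)
      simpa using this

end IsLowerArc

end KnotSum

/-! ### Transfer of torsion; from closed curves to arcs -/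

namespace KnotSum

open scoped unitInterval
open Complex

section

variable {X Y Z : Type*} [TopologicalSpace X] [TopologicalSpace Y] [TopologicalSpace Z]

theorem DetectsLoops.comp {g : C(Y, Z)} {f : C(X, Y)} (hg : DetectsLoops g)
    (hf : DetectsLoops f) : DetectsLoops (g.comp f) :=
  fun x γ h => hf x γ (hg (f x) (γ.map f.continuous) h)

theorem detectsLoops_homeomorph (f : X ≃ₜ Y) : DetectsLoops (f : C(X, Y)) := by
  rintro x γ ⟨H⟩
  refine ⟨{ toFun := fun s => f.symm (H s)
            continuous_toFun := f.symm.continuous.comp H.continuous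
            map_zero_left := fun t => by simp
            map_one_left := fun t => by simp
            prop' := ?_ }⟩
  rintro t s (rfl | rfl) <;> simp

theorem HasGeneralizedTorsion.map {G H : Type*} [Group G] [Group H] (φ : G →* H)
    (hφ : Function.Injective φ) (h : HasGeneralizedTorsion G) : HasGeneralizedTorsion H := by
  obtain ⟨x, hx, l, hl, hprod⟩ := h
  refine ⟨φ x, fun h1 => hx (hφ (by rw [h1, map_one])), l.map φ, by simpa using hl, ?_⟩
  rw [← map_one φ, ← hprod, map_list_prod, List.map_map, List.map_map]
  congr 1
  refine List.map_congr_left fun y _ => ?_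
  simp

theorem DetectsLoops.injective {e : C(X, Y)} (he : DetectsLoops e) (x : X) :
    Function.Injective (FundamentalGroup.map e x) := by
  refine (injective_iff_map_eq_one _).2 fun p hp => ?_
  obtain ⟨γ, rfl⟩ := Path.Homotopic.Quotient.mk_surjective p
  exact Path.Homotopic.Quotient.eq.2 (he x γ (Path.Homotopic.Quotient.exact hp))

theorem HasGeneralizedTorsion.of_detectsLoops [PathConnectedSpace Y] {e : C(X, Y)}
    (he : DetectsLoops e) {x : X} (h : HasGeneralizedTorsion (FundamentalGroup X x)) (y : Y) :
    HasGeneralizedTorsion (FundamentalGroup Y y) :=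
  (h.map _ (he.injective x)).map
    (FundamentalGroup.fundamentalGroupMulEquivOfPathConnected (e x) y).toMonoidHom
    (MulEquiv.injective _)

end

theorem isPreconnected_compl_singleton_circle (c : Circle) :
    IsPreconnected ({c}ᶜ : Set Circle) := by
  have h : ({c}ᶜ : Set Circle)
      -- The factor exp π places the removed point at the excluded angles ±π.
      = (fun θ : ℝ => c * Circle.exp Real.pi * Circle.exp θ) '' Set.Ioo (-Real.pi) Real.pi := by
    have hpi : Circle.exp Real.pi * Circle.exp Real.pi = 1 := by
      rw [← Circle.exp_add, ← two_mul, Circle.exp_two_pi]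
    ext z
    simp only [Set.mem_compl_iff, Set.mem_singleton_iff, Set.mem_image]
    constructor
    · intro hz
      refine ⟨arg ((c * Circle.exp Real.pi)⁻¹ * z : Circle), ⟨neg_pi_lt_arg _, ?_⟩, ?_⟩
      · refine lt_of_le_of_ne (arg_le_pi _) fun h => hz ?_
        have h1 := Circle.exp_arg ((c * Circle.exp Real.pi)⁻¹ * z)
        rw [h, eq_inv_mul_iff_mul_eq, mul_assoc, hpi, mul_one] at h1
        exact h1.symm
      · rw [Circle.exp_arg, mul_inv_cancel_left]
    · rintro ⟨θ, ⟨h1, h2⟩, rfl⟩ h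
      rw [mul_assoc, mul_eq_left] at h
      have h3 : Circle.exp θ = Circle.exp Real.pi := by
        rw [← mul_right_inj (Circle.exp Real.pi), h, hpi]
      have h4 := Circle.arg_exp h1 h2.le
      rw [h3, Circle.arg_exp (by linarith [Real.pi_pos]) le_rfl] at h4
      exact h2.ne h4.symm
  rw [h]
  exact isPreconnected_Ioo.image _ (by fun_prop)

/-- A topological circle stays connected when a point is removed. -/
theorem isPreconnected_diff_singleton {E : Type*} [TopologicalSpace E] {Q : Set E}
    (h : Q ≃ₜ Circle) {x : E} (hx : x ∈ Q) : IsPreconnected (Q \ {x}) := by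
  have e : Q \ {x} = (fun z : Circle => (h.symm z : E)) '' {h ⟨x, hx⟩}ᶜ := by
    ext y
    simp only [Set.mem_sdiff, Set.mem_singleton_iff, Set.mem_image, Set.mem_compl_iff]
    constructor
    · rintro ⟨hy, hne⟩
      exact ⟨h ⟨y, hy⟩, fun h1 => hne (congrArg Subtype.val (h.injective h1)), by simp⟩
    · rintro ⟨z, hz, rfl⟩
      exact ⟨(h.symm z).2, fun h1 => hz (by
        have : h.symm z = ⟨x, hx⟩ := Subtype.ext h1
        rw [← this, h.apply_symm_apply])⟩
  rw [e]
  exact (isPreconnected_compl_singleton_circle _).image _ (by fun_prop)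

/-- The open segment from `-1` to `1` in the plane at height zero. -/
def openUnitSeg : Set (ℂ × ℝ) := {p | p.2 = 0 ∧ p.1.im = 0 ∧ |p.1.re| < 1}

theorem openUnitSeg_subset : openUnitSeg ⊆ unitSeg := fun _ h => ⟨h.1, h.2.1, h.2.2.le⟩

theorem eq_or_eq_of_mem_unitSeg {p : ℂ × ℝ} (hp : p ∈ unitSeg) (hp' : p ∉ openUnitSeg) :
    p.1 = 1 ∨ p.1 = -1 := by
  obtain ⟨h0, h1, h2⟩ := hp
  have h3 : |p.1.re| = 1 := by
    refine le_antisymm h2 ?_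
    by_contra! h
    exact hp' ⟨h0, h1, h⟩
  rcases (abs_eq zero_le_one).1 h3 with h | h
  · exact Or.inl (Complex.ext (by simpa using h) (by simpa using h1))
  · exact Or.inr (Complex.ext (by simpa using h) (by simpa using h1))

/-- Let two closed curves lie in opposite half-spaces and meet the common boundary plane in the same
segment. The complement of the first one maps to the complement of their sum by a map that detects
null-homotopic loops. -/
theorem exists_detectsLoops {Q₁ Q₂ : Set (ℂ × ℝ)} (h₁ : ∀ p ∈ Q₁, p.2 ≤ 0)
    (h₂ : ∀ p ∈ Q₂, 0 ≤ p.2) (hs₁ : Q₁ ∩ {p | p.2 = 0} = unitSeg)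
    (hs₂ : Q₂ ∩ {p | p.2 = 0} = unitSeg) (hQ : IsCompact ((Q₁ ∪ Q₂) \ openUnitSeg))
    (hc : IsPreconnected (Q₂ \ {(0, 0)})) :
    ∃ e : C(↥Q₁ᶜ, ↥((Q₁ ∪ Q₂) \ openUnitSeg)ᶜ), DetectsLoops e := by
  have hm₁ : ∀ p, p ∈ unitSeg → p ∈ Q₁ := fun p hp => (hs₁.symm ▸ hp : p ∈ Q₁ ∩ _).1
  have hm₂ : ∀ p, p ∈ unitSeg → p ∈ Q₂ := fun p hp => (hs₂.symm ▸ hp : p ∈ Q₂ ∩ _).1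
  have hn₁ : ∀ p ∈ Q₁, p.2 = 0 → p ∈ unitSeg := fun p hp h0 => hs₁ ▸ ⟨hp, h0⟩
  have hn₂ : ∀ p ∈ Q₂, p.2 = 0 → p ∈ unitSeg := fun p hp h0 => hs₂ ▸ ⟨hp, h0⟩
  have h1s : ((1 : ℂ), (0 : ℝ)) ∈ unitSeg := ⟨rfl, by simp, by simp⟩
  have h1o : ((1 : ℂ), (0 : ℝ)) ∉ openUnitSeg := fun h => by simpa using h.2.2
  have h2s : ((-1 : ℂ), (0 : ℝ)) ∈ unitSeg := ⟨rfl, by simp, by simp⟩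
  have h2o : ((-1 : ℂ), (0 : ℝ)) ∉ openUnitSeg := fun h => by simpa using h.2.2
  have hA : Q₁ \ openUnitSeg = ((Q₁ ∪ Q₂) \ openUnitSeg) ∩ {p | p.2 ≤ 0} := by
    ext p
    constructor
    · exact fun h => ⟨⟨Or.inl h.1, h.2⟩, h₁ p h.1⟩
    · rintro ⟨⟨h | h, h'⟩, hz⟩
      · exact ⟨h, h'⟩
      · exact ⟨hm₁ p (hn₂ p h (le_antisymm hz (h₂ p h))), h'⟩
  have hB : Q₂ \ openUnitSeg = ((Q₁ ∪ Q₂) \ openUnitSeg) ∩ {p | 0 ≤ p.2} := by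
    ext p
    constructor
    · exact fun h => ⟨⟨Or.inr h.1, h.2⟩, h₂ p h.1⟩
    · rintro ⟨⟨h | h, h'⟩, hz⟩
      · exact ⟨hm₂ p (hn₁ p h (le_antisymm (h₁ p h) hz)), h'⟩
      · exact ⟨h, h'⟩
  have hclA : IsCompact (Q₁ \ openUnitSeg) := by
    rw [hA]; exact hQ.inter_right (isClosed_le continuous_snd continuous_const)
  have hclB : IsClosed (Q₂ \ openUnitSeg) := by
    rw [hB]; exact hQ.isClosed.inter (isClosed_le continuous_const continuous_snd)
  have htaxi : Continuous taxi := by unfold taxi; fun_prop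
  obtain ⟨M, hM⟩ := hclA.bddAbove_image htaxi.continuousOn
  have hlow : IsLowerArc (Q₁ \ openUnitSeg) (M + 1) :=
    { isClosed := hclA.isClosed
      snd_nonpos := fun p hp => h₁ p hp.1
      plane := fun p hp h0 => eq_or_eq_of_mem_unitSeg (hn₁ p hp.1 h0) hp.2
      one_mem := ⟨hm₁ _ h1s, h1o⟩
      neg_one_mem := ⟨hm₁ _ h2s, h2o⟩
      taxi_lt := fun p hp => by linarith [hM ⟨p, hp, rfl⟩] }
  have hup : IsUpperArc (Q₂ \ openUnitSeg) :=
    { isClosed := hclB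
      snd_nonneg := fun p hp => h₂ p hp.1
      plane := fun p hp h0 => eq_or_eq_of_mem_unitSeg (hn₂ p hp.1 h0) hp.2
      one_mem := ⟨hm₂ _ h1s, h1o⟩
      neg_one_mem := ⟨hm₂ _ h2s, h2o⟩
      not_separated := by
        intro M N hM hN hMN hU hpM hpN
        rw [Set.disjoint_left] at hMN
        have hre : Continuous fun p : ℂ × ℝ => p.1.re := by fun_prop
        -- A separation of the arc, with the left and right halves of the segment added to its two
        -- parts, would separate the closed curve without 0: the enlarged parts can meet only at 0.
        have key := isPreconnected_closed_iff.1 hc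
          (M ∪ (unitSeg ∩ {p | p.1.re ≤ 0})) (N ∪ (unitSeg ∩ {p | 0 ≤ p.1.re}))
          (hM.union (isClosed_unitSeg.inter (isClosed_le hre continuous_const)))
          (hN.union (isClosed_unitSeg.inter (isClosed_le continuous_const hre)))
          (by
            rintro p ⟨hp, -⟩
            by_cases ho : p ∈ openUnitSeg
            · rcases le_total p.1.re 0 with h | h
              · exact Or.inl (Or.inr ⟨openUnitSeg_subset ho, h⟩)
              · exact Or.inr (Or.inr ⟨openUnitSeg_subset ho, h⟩)
            · have : p ∈ M ∪ N := hU ▸ ⟨hp, ho⟩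
              exact this.imp Or.inl Or.inl)
          ⟨_, ⟨hm₂ _ h2s, by simp⟩, Or.inl hpM⟩ ⟨_, ⟨hm₂ _ h1s, by simp⟩, Or.inl hpN⟩
        obtain ⟨p, ⟨-, hp0⟩, hpM', hpN'⟩ := key
        have hMA : ∀ q ∈ M, q ∈ Q₂ \ openUnitSeg := fun q hq => hU ▸ Or.inl hq
        have hNA : ∀ q ∈ N, q ∈ Q₂ \ openUnitSeg := fun q hq => hU ▸ Or.inr hq
        rcases hpM' with hp1 | ⟨hp1, hp1'⟩ <;> rcases hpN' with hp2 | ⟨hp2, hp2'⟩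
        · exact hMN hp1 hp2
        · rcases eq_or_eq_of_mem_unitSeg hp2 (hMA p hp1).2 with h | h
          · exact hMN hp1 ((Prod.ext h hp2.1 : p = (1, 0)) ▸ hpN)
          · simp only [Set.mem_ofPred_eq, h] at hp2'
            norm_num at hp2'
        · rcases eq_or_eq_of_mem_unitSeg hp1 (hNA p hp2).2 with h | h
          · simp only [Set.mem_ofPred_eq, h] at hp1'
            norm_num at hp1'
          · exact hMN ((Prod.ext h hp1.1 : p = (-1, 0)) ▸ hpM) hp2
        · refine hp0 (Prod.ext (Complex.ext ?_ ?_) hp1.1)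
          · exact le_antisymm hp1' hp2'
          · exact hp1.2.1 }
  have key := hlow.exists_detectsLoops hup
  have e1 : Q₁ \ openUnitSeg ∪ unitSeg = Q₁ := by
    ext p
    constructor
    · rintro (h | h)
      · exact h.1
      · exact hm₁ p h
    · intro h
      by_cases ho : p ∈ openUnitSeg
      · exact Or.inr (openUnitSeg_subset ho)
      · exact Or.inl ⟨h, ho⟩
  have e2 : Q₁ \ openUnitSeg ∪ Q₂ \ openUnitSeg = (Q₁ ∪ Q₂) \ openUnitSeg :=
    Set.union_sdiff_distrib.symm
  rwa [e1, e2] at key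

end KnotSum

/-! ### Path connectedness of the knot complement; normalizing coordinates -/

namespace KnotSum

open Complex

/-- The union of the lines that join `x` to the points of `K`. -/
def cone (x : E3) (K : Set E3) : Set E3 := {p | ∃ c ∈ K, ∃ s : ℝ, p = x + s • (c - x)}

theorem dimH_cone_range_le {γ : ℝ → E3} (hγ : ContDiff ℝ 1 γ) (x : E3) :
    dimH (cone x (Set.range γ)) ≤ 2 := by
  have h1 : ContDiff ℝ 1 fun q : ℝ × ℝ => x + q.2 • (γ q.1 - x) := by fun_prop
  have h2 : cone x (Set.range γ) ⊆ Set.range fun q : ℝ × ℝ => x + q.2 • (γ q.1 - x) := by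
    rintro p ⟨_, ⟨t, rfl⟩, s, rfl⟩
    exact ⟨(t, s), rfl⟩
  refine (dimH_mono h2).trans (h1.dimH_range_le.trans ?_)
  simp [Module.finrank_prod]

theorem IsKnot.dimH_cone_le {K : Set E3} (hK : IsKnot K) (x : E3) : dimH (cone x K) ≤ 2 := by
  rcases hK.2 with ⟨γ, hγ, -, -, -, rfl⟩ | ⟨S, rfl⟩
  · exact dimH_cone_range_le (hγ.of_le (by exact_mod_cast le_top)) x
  · have h : cone x (⋃ p ∈ S, segment ℝ p.1 p.2)
        ⊆ ⋃ p ∈ (S : Set (E3 × E3)), cone x (Set.range fun t : ℝ => p.1 + t • (p.2 - p.1)) := by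
      rintro q ⟨c, hc, s, rfl⟩
      obtain ⟨p, hp, hcp⟩ := Set.mem_iUnion₂.1 hc
      rw [segment_eq_image'] at hcp
      obtain ⟨t, -, rfl⟩ := hcp
      exact Set.mem_iUnion₂.2 ⟨p, hp, _, ⟨t, rfl⟩, s, rfl⟩
    refine (dimH_mono h).trans ?_
    rw [dimH_bUnion S.countable_toSet]
    exact iSup₂_le fun p _ => dimH_cone_range_le (by fun_prop) x

theorem joinedIn_compl_of_notMem_cone {K : Set E3} {x z : E3} (hx : x ∉ K) (hz : z ∉ cone x K) :
    JoinedIn Kᶜ x z := by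
  refine JoinedIn.of_segment_subset ?_
  rw [segment_eq_image']
  rintro _ ⟨t, -, rfl⟩ hK
  rcases eq_or_ne t 0 with rfl | ht
  · exact hx (by simpa using hK)
  · refine hz ⟨_, hK, t⁻¹, ?_⟩
    rw [add_sub_cancel_left, smul_smul, inv_mul_cancel₀ ht, one_smul, add_sub_cancel]

/-- The points hidden from x or y behind the knot lie in two cones of Hausdorff dimension at most 2,
so some point of 3-space is visible from both. -/
theorem IsKnot.pathConnectedSpace_compl {K : Set E3} (hK : IsKnot K) (x₀ : ↥Kᶜ) :
    PathConnectedSpace ↥Kᶜ := by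
  rw [← isPathConnected_iff_pathConnectedSpace]
  refine isPathConnected_iff.2 ⟨⟨x₀, x₀.2⟩, fun x hx y hy => ?_⟩
  have hd : Dense (cone x K ∪ cone y K)ᶜ := by
    refine dense_compl_of_dimH_lt_finrank ?_
    rw [dimH_union]
    refine (max_le (hK.dimH_cone_le x) (hK.dimH_cone_le y)).trans_lt ?_
    simp
    norm_num
  obtain ⟨z, hz⟩ := hd.nonempty
  rw [Set.mem_compl_iff, Set.mem_union, not_or] at hz
  exact (joinedIn_compl_of_notMem_cone hx hz.1).trans (joinedIn_compl_of_notMem_cone hy hz.2).symm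

/-- Generalized torsion passes from the complement of the lower curve to the complement of the sum,
in coordinates in which the two curves share the segment from `-1` to `1`. -/
theorem hasGeneralizedTorsion_of_standard {K₁ K₂ K : Set E3} {Q₁ Q₂ : Set (ℂ × ℝ)}
    (hK₂ : Nonempty (K₂ ≃ₜ Circle)) (hK : IsKnot K) (f₁ f₂ f : E3 ≃ₜ ℂ × ℝ)
    (hf₁ : f₁ '' K₁ = Q₁) (hf₂ : f₂ '' K₂ = Q₂) (hf : f '' K = (Q₁ ∪ Q₂) \ openUnitSeg)
    (h₁ : ∀ p ∈ Q₁, p.2 ≤ 0) (h₂ : ∀ p ∈ Q₂, 0 ≤ p.2)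
    (hs₁ : Q₁ ∩ {p | p.2 = 0} = unitSeg) (hs₂ : Q₂ ∩ {p | p.2 = 0} = unitSeg)
    (x₁ : ↥K₁ᶜ) (x : ↥Kᶜ) (h : HasGeneralizedTorsion (KnotGroup K₁ x₁)) :
    HasGeneralizedTorsion (KnotGroup K x) := by
  have := hK.pathConnectedSpace_compl x
  obtain ⟨c⟩ := hK.1
  obtain ⟨c₂⟩ := hK₂
  have hcomp : IsCompact K := isCompact_iff_compactSpace.2 c.symm.compactSpace
  have h0 : ((0 : ℂ), (0 : ℝ)) ∈ Q₂ := by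
    have h0s : ((0 : ℂ), (0 : ℝ)) ∈ unitSeg := ⟨rfl, by simp, by simp⟩
    rw [← hs₂] at h0s
    exact h0s.1
  have hpre : IsPreconnected (Q₂ \ {(0, 0)}) := by
    subst hf₂
    exact isPreconnected_diff_singleton ((f₂.image K₂).symm.trans c₂) h0
  obtain ⟨e, he⟩ := exists_detectsLoops h₁ h₂ hs₁ hs₂ (hf ▸ hcomp.image f.continuous) hpre
  have hmem : ∀ (g : E3 ≃ₜ ℂ × ℝ) (S : Set E3) (T : Set (ℂ × ℝ)), g '' S = T →
      ∀ y, y ∈ Sᶜ ↔ g y ∈ Tᶜ := by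
    rintro g S _ rfl y
    simp
  let g₁ : ↥K₁ᶜ ≃ₜ ↥Q₁ᶜ := f₁.subtype (hmem f₁ _ _ hf₁)
  let g : ↥Kᶜ ≃ₜ ↥((Q₁ ∪ Q₂) \ openUnitSeg)ᶜ := f.subtype (hmem f _ _ hf)
  exact h.of_detectsLoops
    ((detectsLoops_homeomorph g.symm).comp (he.comp (detectsLoops_homeomorph g₁))) x

/-- The affine coordinates on 3-space in which `a` and `b`, points at height zero with distinct
projections, become `1` and `-1`; the height is multiplied by the sign `σ`. -/
noncomputable def coordinates (a b : ℂ) (hab : a ≠ b) (σ : ℝ) (hσ : σ * σ = 1) : E3 ≃ₜ ℂ × ℝ where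
  toFun x := ((2 * ((x 0 : ℂ) + x 1 * I) - (a + b)) / (a - b), σ * x 2)
  invFun p := !₂[((p.1 * (a - b) + (a + b)) / 2).re, ((p.1 * (a - b) + (a + b)) / 2).im, σ * p.2]
  left_inv x := by
    have h : a - b ≠ 0 := sub_ne_zero.2 hab
    have e : ((2 * ((x 0 : ℂ) + x 1 * I) - (a + b)) / (a - b) * (a - b) + (a + b)) / 2
        = (x 0 : ℂ) + x 1 * I := by field_simp; ring
    ext i
    simp only [e]
    fin_cases i
    · simp
    · simp
    · simp [← mul_assoc, hσ]
  right_inv p := by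
    have h : a - b ≠ 0 := sub_ne_zero.2 hab
    ext1
    · simp only [Matrix.cons_val_zero, Matrix.cons_val_one, re_add_im]
      field_simp
      ring
    · simp [← mul_assoc, hσ]
  continuous_toFun := by fun_prop
  continuous_invFun := by
    refine (PiLp.continuous_toLp 2 _).comp (continuous_pi fun i => ?_)
    fin_cases i
    · simpa using by fun_prop
    · simpa using by fun_prop
    · simpa using by fun_prop

theorem coordinates_apply (a b : ℂ) (hab : a ≠ b) (σ : ℝ) (hσ : σ * σ = 1) (x : E3) :
    coordinates a b hab σ hσ x
      = ((2 * ((x 0 : ℂ) + x 1 * I) - (a + b)) / (a - b), σ * x 2) := rfl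

theorem coordinates_line {a b : E3} (ha : a 2 = 0) (hb : b 2 = 0)
    (hab : (a 0 + a 1 * I : ℂ) ≠ b 0 + b 1 * I) (σ : ℝ) (hσ : σ * σ = 1) (t : ℝ) :
    coordinates _ _ hab σ hσ (a + t • (b - a)) = (((1 - 2 * t : ℝ) : ℂ), 0) := by
  have h := sub_ne_zero.2 hab
  rw [coordinates_apply]
  ext1
  · simp only [PiLp.add_apply, PiLp.smul_apply, PiLp.sub_apply, smul_eq_mul]
    rw [div_eq_iff h]
    push_cast
    ring
  · simp [ha, hb]

theorem coordinates_image_segment {a b : E3} (ha : a 2 = 0) (hb : b 2 = 0)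
    (hab : (a 0 + a 1 * I : ℂ) ≠ b 0 + b 1 * I) (σ : ℝ) (hσ : σ * σ = 1) :
    coordinates _ _ hab σ hσ '' segment ℝ a b = unitSeg := by
  rw [segment_eq_image', Set.image_image]
  simp only [coordinates_line ha hb]
  ext p
  constructor
  · rintro ⟨t, ⟨h0, h1⟩, rfl⟩
    refine ⟨rfl, ofReal_im _, ?_⟩
    rw [ofReal_re, abs_le]
    constructor <;> linarith
  · rintro ⟨h0, h1, h2⟩
    rw [abs_le] at h2
    refine ⟨(1 - p.1.re) / 2, ⟨by linarith, by linarith⟩, ?_⟩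
    refine Prod.ext (Complex.ext ?_ ?_) h0.symm
    · rw [ofReal_re]; ring
    · rw [ofReal_im, h1]

theorem coordinates_image_openSegment {a b : E3} (ha : a 2 = 0) (hb : b 2 = 0)
    (hab : (a 0 + a 1 * I : ℂ) ≠ b 0 + b 1 * I) (σ : ℝ) (hσ : σ * σ = 1) :
    coordinates _ _ hab σ hσ '' openSegment ℝ a b = openUnitSeg := by
  rw [openSegment_eq_image', Set.image_image]
  simp only [coordinates_line ha hb]
  ext p
  constructor
  · rintro ⟨t, ⟨h0, h1⟩, rfl⟩
    refine ⟨rfl, ofReal_im _, ?_⟩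
    rw [ofReal_re, abs_lt]
    constructor <;> linarith
  · rintro ⟨h0, h1, h2⟩
    rw [abs_lt] at h2
    refine ⟨(1 - p.1.re) / 2, ⟨by linarith, by linarith⟩, ?_⟩
    refine Prod.ext (Complex.ext ?_ ?_) h0.symm
    · rw [ofReal_re]; ring
    · rw [ofReal_im, h1]

/-- Generalized torsion passes to the connected sum from the summand on the side of the plane where
`σ * x 2` is nonpositive. -/
theorem hasGeneralizedTorsion_of_sign {K₁ K₂ K Q₁ Q₂ : Set E3} {a b : E3}
    (hK₂ : Nonempty (K₂ ≃ₜ Circle)) (hK : IsKnot K) (hab : a ≠ b) (σ : ℝ) (hσ : σ * σ = 1)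
    (h₁ : ∀ p ∈ Q₁, σ * p 2 ≤ 0) (h₂ : ∀ p ∈ Q₂, 0 ≤ σ * p 2)
    (hs₁ : Q₁ ∩ {x | x 2 = 0} = segment ℝ a b) (hs₂ : Q₂ ∩ {x | x 2 = 0} = segment ℝ a b)
    (hi₁ : AmbientIsotopic K₁ Q₁) (hi₂ : AmbientIsotopic K₂ Q₂)
    (hi : AmbientIsotopic K ((Q₁ ∪ Q₂) \ openSegment ℝ a b))
    (x₁ : ↥K₁ᶜ) (x : ↥Kᶜ) (h : HasGeneralizedTorsion (KnotGroup K₁ x₁)) :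
    HasGeneralizedTorsion (KnotGroup K x) := by
  obtain ⟨F₁, -, -, hF₁⟩ := hi₁
  obtain ⟨F₂, -, -, hF₂⟩ := hi₂
  obtain ⟨F, -, -, hF⟩ := hi
  have ha : a 2 = 0 := (hs₁.symm ▸ left_mem_segment ℝ a b : a ∈ Q₁ ∩ {x | x 2 = 0}).2
  have hb : b 2 = 0 := (hs₁.symm ▸ right_mem_segment ℝ a b : b ∈ Q₁ ∩ {x | x 2 = 0}).2
  have hab' : (a 0 + a 1 * I : ℂ) ≠ b 0 + b 1 * I := by
    intro h
    have hre := congrArg re h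
    have him := congrArg im h
    simp at hre him
    refine hab ?_
    ext i
    fin_cases i
    · exact hre
    · exact him
    · exact ha.trans hb.symm
  let Φ := coordinates _ _ hab' σ hσ
  have hσ0 : σ ≠ 0 := by rintro rfl; simp at hσ
  have hΦ : ∀ p : E3, (Φ p).2 = σ * p 2 := fun _ => rfl
  have hΦs : Φ '' segment ℝ a b = unitSeg := coordinates_image_segment ha hb hab' σ hσ
  have hplane : ∀ Q : Set E3, Q ∩ {x | x 2 = 0} = segment ℝ a b →
      Φ '' Q ∩ {p | p.2 = 0} = unitSeg := by
    intro Q hQ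
    rw [← hΦs, ← hQ]
    ext p
    constructor
    · rintro ⟨⟨q, hq, rfl⟩, h0⟩
      exact ⟨q, ⟨hq, (mul_eq_zero.1 h0).resolve_left hσ0⟩, rfl⟩
    · rintro ⟨q, ⟨hq, h0⟩, rfl⟩
      refine ⟨⟨q, hq, rfl⟩, ?_⟩
      change σ * q 2 = 0
      rw [show q 2 = 0 from h0, mul_zero]
  have himage : ∀ (G : E3 ≃ₜ E3) (S T : Set E3), G '' S = T → G.trans Φ '' S = Φ '' T := by
    rintro G S _ rfl
    rw [Set.image_image]
    rfl
  refine hasGeneralizedTorsion_of_standard hK₂ hK ((F₁ 1).trans Φ) ((F₂ 1).trans Φ)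
    ((F 1).trans Φ) (himage _ _ _ hF₁) (himage _ _ _ hF₂) ?_ ?_ ?_ (hplane _ hs₁) (hplane _ hs₂)
    x₁ x h
  · rw [himage _ _ _ hF, Set.image_sdiff Φ.injective, Set.image_union,
      coordinates_image_openSegment ha hb]
  · rintro _ ⟨p, hp, rfl⟩
    exact h₁ p hp
  · rintro _ ⟨p, hp, rfl⟩
    exact h₂ p hp

end KnotSum

theorem corollary9 (K₁ K₂ K : Set KnotSum.E3)
    (hK₁ : KnotSum.IsKnot K₁) (hK₂ : KnotSum.IsKnot K₂) (hK : KnotSum.IsKnot K)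
    (hsum : KnotSum.IsConnectedSum K₁ K₂ K)
    (x₁ : ↥K₁ᶜ) (x₂ : ↥K₂ᶜ) (x : ↥Kᶜ)
    (h : KnotSum.HasGeneralizedTorsion (KnotSum.KnotGroup K₁ x₁) ∨
      KnotSum.HasGeneralizedTorsion (KnotSum.KnotGroup K₂ x₂)) :
    KnotSum.HasGeneralizedTorsion (KnotSum.KnotGroup K x) := by
  obtain ⟨Q₁, Q₂, a, b, hab, h₁, h₂, hs₁, hs₂, hi₁, hi₂, hi⟩ := hsum
  rcases h with h | h
  · refine KnotSum.hasGeneralizedTorsion_of_sign hK₂.1 hK hab 1 (by norm_num) (fun p hp => ?_)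
      (fun p hp => ?_) hs₁ hs₂ hi₁ hi₂ hi x₁ x h
    · rw [one_mul]; exact h₁ hp
    · rw [one_mul]; exact h₂ hp
  -- The sign -1 reflects the height, which makes the second summand the lower one.
  · refine KnotSum.hasGeneralizedTorsion_of_sign hK₁.1 hK hab (-1) (by norm_num) (fun p hp => ?_)
      (fun p hp => ?_) hs₂ hs₁ hi₂ hi₁ (Set.union_comm Q₁ Q₂ ▸ hi) x₂ x h
    · have : 0 ≤ p 2 := h₂ hp
      linarith
    · have : p 2 ≤ 0 := h₁ hp
      linarith
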